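/- Let $\mathcal B\subseteq\mathcal B(\mathcal H)$ be a von Neumann algebra acting on a Hilbert space $\mathcal H$ and let $\Omega$ be a set. A kernel $\mathfrak K:\Omega\times\Omega\to\mathcal B(\mathcal B,\mathcal B)$ (bounded linear maps on $\mathcal B$) is a CPD-kernel if $\sum_{i,j}c_i^*\,\mathfrak K^{\sigma_i,\sigma_j}(b_i^*b_j)\,c_j\ge 0$ for all finite choices $\sigma_i\in\Omega$, $b_i,c_i\in\mathcal B$. A Hilbert $\mathcal B$-module $E$ (right module, $\mathcal B$-valued inner product $\langle\cdot,\cdot\rangle$ linear in the second variable) is identified with $\{L_x:x\in E\}\subseteq\mathcal B(\mathcal H,E\otimes\mathcal H)$, where $E\otimes\mathcal H$ is the interior tensor product and $L_xh=x\otimes h$; it is a von Neumann $\mathcal B$-module if this set is strongly closed. A minimal Kolmogorov decomposition of $\mathfrak K$ is a pair $(\mathcal F,\mathfrak i)$ of a von Neumann $\mathcal B$-module $\mathcal F$, with a left action of $\mathcal B$ by a unital $*$-homomorphism into the adjointable operators on $\mathcal F$, and a map $\mathfrak i:\Omega\to\mathcal F$ such that $\mathfrak K^{\sigma,\sigma'}(b)=\langle\mathfrak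 i(\sigma),b\,\mathfrak i(\sigma')\rangle$ for all $\sigma,\sigma'\in\Omega$, $b\in\mathcal B$, and the linear span of $\{b\,\mathfrak i(\sigma)\,c: b,c\in\mathcal B,\ \sigma\in\Omega\}$ is strongly dense in $\mathcal F$. Let $\mathfrak K$ be a CPD-kernel over $\Omega$ from $\mathcal B$ to $\mathcal B$ and $(\mathcal F,\mathfrak i)$ its minimal Kolmogorov decomposition. Then the following are equivalent: (i) there is a unit vector $\zeta$, i.e. $\langle\zeta,\zeta\rangle=1_{\mathcal B}$, in the center $\{f\in\mathcal F: bf=fb\text{ for all }b\in\mathcal B\}$ of $\mathcal F$; (ii) there is a two-sided $\mathcal B$-submodule $\mathcal F'$ of $\mathcal F$ that is a von Neumann $\mathcal B$-module, and an inner-product-preserving two-sided $\mathcal B$-linear bijection from $\mathcal F$ onto $\mathcal B\oplus\mathcal F'$, where $\mathcal B$ carries the inner product $\langle a,b\rangle=a^*b$; (iii) there are elements $b^\sigma\in\mathcal B$ $(\sigma\in\Omega)$ such that the strongly closed two-sided ideal of $\mathcal B$ generated by $\{b^\sigma:\sigma\in\Omega\}$ is $\mathcal B$, and a CPD-kernel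 $\mathfrak L$ over $\Omega$ from $\mathcal B$ to $\mathcal B$ such that $\mathfrak K^{\sigma,\sigma'}(b)=(b^\sigma)^*\,b\,b^{\sigma'}+\mathfrak L^{\sigma,\sigma'}(b)$ for all $b\in\mathcal B$, $\sigma,\sigma'\in\Omega$. Moreover, for every family $(b^\sigma)_{\sigma\in\Omega}$ in $\mathcal B$, the kernel $(\sigma,\sigma')\mapsto\big(b\mapsto (b^\sigma)^*\,b\,b^{\sigma'}\big)$ is a CPD-kernel. -/

import Mathlib

noncomputable section

open scoped TensorProduct RightActions InnerProductSpace

namespace VNKernel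

/-! ### The von Neumann algebra as a C*-algebra -/

section Algebra

variable {H : Type*} [NormedAddCommGroup H] [InnerProductSpace ℂ H] [CompleteSpace H]

instance instSMulMemClass : SMulMemClass (VonNeumannAlgebra H) ℂ (H →L[ℂ] H) where
  smul_mem {s} z _ hx := s.toStarSubalgebra.smul_mem hx z

/-- A von Neumann algebra is norm closed; this makes `↥𝓑` a C*-algebra. -/
instance instIsClosed (𝓑 : VonNeumannAlgebra H) : IsClosed (𝓑 : Set (H →L[ℂ] H)) := by
  rw [← 𝓑.centralizer_centralizer]
  exact Set.isClosed_centralizer _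

end Algebra

/-! ### The strong operator topology -/

section Strong

variable {H K : Type*} [NormedAddCommGroup H] [NormedSpace ℂ H]
  [NormedAddCommGroup K] [NormedSpace ℂ K]

/-- The closure of a set of bounded operators in the strong operator topology (the topology of
pointwise convergence on `H`). -/
def strongClosure (S : Set (H →L[ℂ] K)) : Set (H →L[ℂ] K) :=
  ContinuousLinearMap.toPointwiseConvergenceCLM ℂ (RingHom.id ℂ) H K ⁻¹'
    closure (ContinuousLinearMap.toPointwiseConvergenceCLM ℂ (RingHom.id ℂ) H K '' S)

/-- A set of bounded operators is strongly closed. -/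
def IsStronglyClosed (S : Set (H →L[ℂ] K)) : Prop :=
  IsClosed (ContinuousLinearMap.toPointwiseConvergenceCLM ℂ (RingHom.id ℂ) H K '' S)

end Strong

variable {H : Type*} [NormedAddCommGroup H] [InnerProductSpace ℂ H] [CompleteSpace H]

/-! ### Hilbert modules and bimodules -/

/-- (Right) Hilbert modules over `𝓑`, with inner product linear in the second variable. The right
action of `b` is `x <• b`. Completeness of `E` is a separate instance argument. Positivity in `𝓑` is
positivity of operators on `H`. (Mathlib's `CStarModule` has `⟪x, a • y⟫ = a * ⟪x, y⟫` and so is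
the left-handed version.) -/
class HilbertModule (𝓑 : VonNeumannAlgebra H) (E : Type*) [NormedAddCommGroup E]
    [NormedSpace ℂ E] extends toRightModule : Module (↥𝓑)ᵐᵒᵖ E where
  smul_complex_right (z : ℂ) (x : E) (b : 𝓑) : x <• (z • b) = z • (x <• b)
  /-- the `𝓑`-valued inner product -/
  inn : E → E → 𝓑
  inn_self_nonneg (x : E) : 0 ≤ (inn x x : H →L[ℂ] H)
  inn_self_eq_zero (x : E) : inn x x = 0 → x = 0
  inn_smul_right (x y : E) (b : 𝓑) : inn x (y <• b) = inn x y * b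
  star_inn (x y : E) : star (inn y x) = inn x y
  inn_add_right (x y z : E) : inn x (y + z) = inn x y + inn x z
  inn_smul_complex (μ : ℂ) (x y : E) : inn x (μ • y) = μ • inn x y
  norm_sq_eq (x : E) : ‖x‖ ^ 2 = ‖inn x x‖

/-- Hilbert modules over `𝓑` with a left action of `𝓑` by a unital `*`-homomorphism into the
adjointable operators, i.e. correspondences from `𝓑` to `𝓑`. The left action of `b` is `b • x`. -/
class HilbertBimodule (𝓑 : VonNeumannAlgebra H) (E : Type*) [NormedAddCommGroup E]
    [NormedSpace ℂ E] extends HilbertModule 𝓑 E where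
  [leftModule : Module (↥𝓑) E]
  smul_complex_left (z : ℂ) (b : 𝓑) (x : E) : (z • b) • x = z • (b • x)
  smul_left_right (b c : 𝓑) (x : E) : b • (x <• c) = (b • x) <• c
  inn_smul_left (b : 𝓑) (x y : E) : inn (b • x) y = inn x (star b • y)

attribute [reducible, instance] HilbertBimodule.leftModule

/-- The `𝓑`-valued inner product `⟨x, y⟩`. -/
abbrev inn (𝓑 : VonNeumannAlgebra H) {E : Type*} [NormedAddCommGroup E] [NormedSpace ℂ E]
    [HilbertModule 𝓑 E] (x y : E) : 𝓑 := HilbertModule.inn x y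

section Basic

variable {𝓑 : VonNeumannAlgebra H} {E : Type*} [NormedAddCommGroup E] [NormedSpace ℂ E]
  [HilbertModule 𝓑 E]

theorem star_inn (x y : E) : star (inn 𝓑 y x) = inn 𝓑 x y := HilbertModule.star_inn x y

theorem inn_add_right (x y z : E) : inn 𝓑 x (y + z) = inn 𝓑 x y + inn 𝓑 x z :=
  HilbertModule.inn_add_right x y z

theorem inn_smul_right (x y : E) (b : 𝓑) : inn 𝓑 x (y <• b) = inn 𝓑 x y * b :=
  HilbertModule.inn_smul_right x y b

theorem inn_smul_complex (μ : ℂ) (x y : E) : inn 𝓑 x (μ • y) = μ • inn 𝓑 x y :=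
  HilbertModule.inn_smul_complex μ x y

theorem inn_add_left (x y z : E) : inn 𝓑 (x + y) z = inn 𝓑 x z + inn 𝓑 y z := by
  rw [← star_inn, inn_add_right, star_add, star_inn, star_inn]

theorem inn_smul_complex_left (μ : ℂ) (x y : E) :
    inn 𝓑 (μ • x) y = (starRingEnd ℂ μ) • inn 𝓑 x y := by
  rw [← star_inn, inn_smul_complex, star_smul, star_inn]
  rfl

/-- The inner product as a biadditive map. -/
def innHom (𝓑 : VonNeumannAlgebra H) {E : Type*} [NormedAddCommGroup E] [NormedSpace ℂ E]
    [HilbertModule 𝓑 E] : E →+ E →+ 𝓑 :=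
  AddMonoidHom.mk' (fun x => AddMonoidHom.mk' (inn 𝓑 x) (inn_add_right x))
    fun x y => by ext z : 1; exact inn_add_left x y z

theorem inn_sum_left {ι : Type*} (s : Finset ι) (x : ι → E) (y : E) :
    inn 𝓑 (∑ k ∈ s, x k) y = ∑ k ∈ s, inn 𝓑 (x k) y :=
  map_sum ((innHom 𝓑).flip y) x s

theorem inn_sum_right {ι : Type*} (s : Finset ι) (x : E) (y : ι → E) :
    inn 𝓑 x (∑ k ∈ s, y k) = ∑ k ∈ s, inn 𝓑 x (y k) :=
  map_sum (innHom 𝓑 x) y s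

theorem inn_smul_right_left (x y : E) (b : 𝓑) :
    inn 𝓑 (x <• b) y = star b * inn 𝓑 x y := by
  rw [← star_inn, inn_smul_right, star_mul, star_inn]

theorem coe_inn_star (x y : E) :
    ContinuousLinearMap.adjoint (inn 𝓑 x y : H →L[ℂ] H) = (inn 𝓑 y x : H →L[ℂ] H) := by
  rw [← star_inn y x]
  rfl

theorem exists_of_isSelfAdjoint {A : Type*} [CStarAlgebra A] {t : A} (ht : IsSelfAdjoint t) :
    ∃ a c : A, star a = a ∧ a * t * a = -(star c * c) ∧ (c = 0 → ∃ r, t = star r * r) := by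
  let _ : PartialOrder A := CStarAlgebra.spectralOrder A
  have : StarOrderedRing A := CStarAlgebra.spectralOrderedRing A
  have hdec : t⁺ - t⁻ = t := CFC.posPart_sub_negPart t ht
  have hnp : t⁻ * t⁺ = 0 := CFC.negPart_mul_posPart t
  have hapos : 0 ≤ t⁻ := CFC.negPart_nonneg t
  have hppos : 0 ≤ t⁺ := CFC.posPart_nonneg t
  have hasa : star t⁻ = t⁻ := (IsSelfAdjoint.of_nonneg hapos).star_eq
  obtain ⟨s, hs⟩ := CStarAlgebra.nonneg_iff_eq_star_mul_self.1 hapos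
  generalize t⁻ = a at *
  generalize t⁺ = p at *
  have haaa : star (s * a) * (s * a) = a * a * a := by
    rw [star_mul, hasa, mul_assoc a (star s), ← mul_assoc (star s), ← hs, mul_assoc]
  refine ⟨a, s * a, hasa, ?_, fun hc => ?_⟩
  · rw [haaa, ← hdec, mul_sub, hnp, zero_sub, neg_mul]
  · have h3 : a * a * a = 0 := by rw [← haaa, hc, mul_zero]
    have h4 : star (star a * a) * (star a * a) = 0 := by
      rw [star_mul, star_star, hasa, ← mul_assoc, h3, zero_mul]
    have ha0 : a = 0 := (CStarRing.star_mul_self_eq_zero_iff _).1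
      ((CStarRing.star_mul_self_eq_zero_iff _).1 h4)
    rw [ha0, sub_zero] at hdec
    rw [← hdec]
    exact CStarAlgebra.nonneg_iff_eq_star_mul_self.1 hppos

/-- Gram matrices are positive. -/
theorem exists_gram_eq {ι : Type*} [Fintype ι] (x : ι → E) :
    ∃ s : ι → ι → 𝓑, ∀ k l, inn 𝓑 (x k) (x l) = ∑ m, star (s m k) * s m l := by
  classical
  let _ : PartialOrder 𝓑 := CStarAlgebra.spectralOrder 𝓑
  have : StarOrderedRing 𝓑 := CStarAlgebra.spectralOrderedRing 𝓑
  let T : CStarMatrix ι ι 𝓑 := CStarMatrix.ofMatrix (Matrix.of fun k l => inn 𝓑 (x k) (x l))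
  have hT : ∀ k l, T k l = inn 𝓑 (x k) (x l) := fun _ _ => rfl
  have hTsa : IsSelfAdjoint T := by
    ext k l
    rw [CStarMatrix.star_apply, hT, hT, star_inn]
  obtain ⟨a, c, hasa, hata, hc0⟩ := exists_of_isSelfAdjoint hTsa
  have hcoe : ∀ (f : ι → 𝓑), ((∑ m, f m : 𝓑) : H →L[ℂ] H) = ∑ m, (f m : H →L[ℂ] H) :=
    fun f => map_sum (SubringClass.subtype 𝓑) f Finset.univ
  have hc : c = 0 := by
    have hkk : ∀ k, (a * T * a) k k = inn 𝓑 (∑ m, x m <• a m k) (∑ m, x m <• a m k) := by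
      intro k
      rw [inn_sum_right, CStarMatrix.mul_apply]
      refine Finset.sum_congr rfl fun m _ => ?_
      rw [inn_smul_right, inn_sum_left, CStarMatrix.mul_apply]
      congr 1
      refine Finset.sum_congr rfl fun l _ => ?_
      rw [inn_smul_right_left, hT, ← CStarMatrix.star_apply, hasa]
    have hkk' : ∀ k, (star c * c) k k = ∑ m, star (c m k) * c m k := by
      intro k
      rw [CStarMatrix.mul_apply]
      rfl
    have hnn : ∀ k m, 0 ≤ ((star (c m k) * c m k : 𝓑) : H →L[ℂ] H) :=
      fun k m => star_mul_self_nonneg (c m k : H →L[ℂ] H)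
    ext m k : 2
    have h0 : ∑ m, ((star (c m k) * c m k : 𝓑) : H →L[ℂ] H) = 0 := by
      apply le_antisymm
      · have h2 := HilbertModule.inn_self_nonneg (𝓑 := 𝓑) (∑ m, x m <• a m k)
        have h3 : (inn 𝓑 (∑ m, x m <• a m k) (∑ m, x m <• a m k) : 𝓑)
            = -∑ m, star (c m k) * c m k := by
          rw [← hkk, hata, ← hkk']
          rfl
        change 0 ≤ ((inn 𝓑 (∑ m, x m <• a m k) (∑ m, x m <• a m k) : 𝓑) : H →L[ℂ] H) at h2
        rw [h3] at h2
        have h4 : ((-∑ m, star (c m k) * c m k : 𝓑) : H →L[ℂ] H)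
            = -∑ m, ((star (c m k) * c m k : 𝓑) : H →L[ℂ] H) := by
          rw [← hcoe]
          rfl
        rw [h4] at h2
        exact neg_nonneg.1 h2
      · exact Finset.sum_nonneg fun m _ => hnn k m
    have h1 := (Finset.sum_eq_zero_iff_of_nonneg fun m _ => hnn k m).1 h0 m (Finset.mem_univ m)
    exact (CStarRing.star_mul_self_eq_zero_iff (c m k : H →L[ℂ] H)).1 h1
  obtain ⟨r, hr⟩ := hc0 hc
  refine ⟨fun m k => r m k, fun k l => ?_⟩
  rw [← hT, hr, CStarMatrix.mul_apply]
  rfl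

theorem gram_form_nonneg {ι : Type*} [Fintype ι] (x : ι → E) (h : ι → H) :
    0 ≤ RCLike.re (∑ k, ∑ l, ⟪h k, (inn 𝓑 (x k) (x l) : H →L[ℂ] H) (h l)⟫_ℂ) := by
  obtain ⟨s, hs⟩ := exists_gram_eq (𝓑 := 𝓑) x
  have hcoe : ∀ (f : ι → 𝓑), ((∑ m, f m : 𝓑) : H →L[ℂ] H) = ∑ m, (f m : H →L[ℂ] H) :=
    fun f => map_sum (SubringClass.subtype 𝓑) f Finset.univ
  have key : ∑ k, ∑ l, ⟪h k, (inn 𝓑 (x k) (x l) : H →L[ℂ] H) (h l)⟫_ℂ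
      = ∑ m, ⟪∑ k, (s m k : H →L[ℂ] H) (h k), ∑ l, (s m l : H →L[ℂ] H) (h l)⟫_ℂ := by
    have hm : ∀ m, ⟪∑ k, (s m k : H →L[ℂ] H) (h k), ∑ l, (s m l : H →L[ℂ] H) (h l)⟫_ℂ
        = ∑ k, ∑ l, ⟪(s m k : H →L[ℂ] H) (h k), (s m l : H →L[ℂ] H) (h l)⟫_ℂ := fun m => by
      rw [sum_inner]
      exact Finset.sum_congr rfl fun k _ => inner_sum _ _ _
    rw [Finset.sum_congr rfl fun m _ => hm m]
    symm
    rw [Finset.sum_comm]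
    refine Finset.sum_congr rfl fun k _ => ?_
    rw [Finset.sum_comm]
    refine Finset.sum_congr rfl fun l _ => ?_
    symm
    rw [hs, hcoe, sum_apply, inner_sum]
    refine Finset.sum_congr rfl fun m _ => ?_
    change ⟪h k, (ContinuousLinearMap.adjoint (s m k : H →L[ℂ] H)) ((s m l : H →L[ℂ] H) (h l))⟫_ℂ = _
    rw [ContinuousLinearMap.adjoint_inner_right]
  rw [key, map_sum]
  exact Finset.sum_nonneg fun m _ => inner_self_nonneg

end Basic

/-! ### The interior tensor product with `H` -/

section Interior

variable (𝓑 : VonNeumannAlgebra H) (E : Type*) [NormedAddCommGroup E] [NormedSpace ℂ E]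

/-- The algebraic tensor product `E ⊗ H` over `ℂ`, to be equipped with the semi-inner product
`⟪x ⊗ h, y ⊗ k⟫ = ⟪h, ⟨x, y⟩ k⟫`. -/
def PreInterior (_ : VonNeumannAlgebra H) (E : Type*) [NormedAddCommGroup E]
    [NormedSpace ℂ E] : Type _ := E ⊗[ℂ] H

instance : AddCommGroup (PreInterior 𝓑 E) := inferInstanceAs (AddCommGroup (E ⊗[ℂ] H))

instance : Module ℂ (PreInterior 𝓑 E) := inferInstanceAs (Module ℂ (E ⊗[ℂ] H))

variable {E} in
/-- The elementary tensor `x ⊗ h`. -/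
def preTmul (x : E) (h : H) : PreInterior 𝓑 E := x ⊗ₜ[ℂ] h

variable [HilbertModule 𝓑 E]

/-- The sesquilinear form on `E ⊗ H` with `(x ⊗ h, y ⊗ k) ↦ ⟪h, ⟨x, y⟩ k⟫`. -/
def interiorForm : (E ⊗[ℂ] H) →ₗ⋆[ℂ] (E ⊗[ℂ] H) →ₗ[ℂ] ℂ :=
  TensorProduct.lift
    (LinearMap.mk₂'ₛₗ (starRingEnd ℂ) (starRingEnd ℂ)
      (fun (x : E) (h : H) => TensorProduct.lift
        (LinearMap.mk₂ ℂ (fun (y : E) (k : H) => ⟪h, (inn 𝓑 x y : H →L[ℂ] H) k⟫_ℂ)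
          (fun y y' k => by
            rw [inn_add_right]; exact inner_add_right _ _ _)
          (fun c y k => by
            rw [inn_smul_complex]; exact inner_smul_right _ _ _)
          (fun y k k' => by rw [map_add, inner_add_right])
          (fun c y k => by rw [map_smul, inner_smul_right]; rfl)))
      (fun x x' h => by
        ext y k
        change ⟪h, (inn 𝓑 (x + x') y : H →L[ℂ] H) k⟫_ℂ = _
        rw [inn_add_left]; exact inner_add_right _ _ _)
      (fun c x h => by
        ext y k
        change ⟪h, (inn 𝓑 (c • x) y : H →L[ℂ] H) k⟫_ℂ = _
        rw [inn_smul_complex_left]; exact inner_smul_right _ _ _)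
      (fun x h h' => by ext y k; exact inner_add_left _ _ _)
      (fun c x h => by ext y k; exact inner_smul_left _ _ _))

theorem interiorForm_tmul (x y : E) (h k : H) :
    interiorForm 𝓑 E (x ⊗ₜ h) (y ⊗ₜ k) = ⟪h, (inn 𝓑 x y : H →L[ℂ] H) k⟫_ℂ := rfl

theorem interiorForm_conj (s t : E ⊗[ℂ] H) :
    starRingEnd ℂ (interiorForm 𝓑 E t s) = interiorForm 𝓑 E s t := by
  induction s using TensorProduct.induction_on with
  | zero => simp
  | add s s' hs hs' => rw [map_add, map_add, map_add, LinearMap.add_apply, hs, hs']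
  | tmul x h =>
    induction t using TensorProduct.induction_on with
    | zero => simp
    | add t t' ht ht' => rw [map_add, LinearMap.add_apply, map_add, map_add, ht, ht']
    | tmul y k =>
      rw [interiorForm_tmul, interiorForm_tmul, inner_conj_symm, ← coe_inn_star (𝓑 := 𝓑) y x,
        ContinuousLinearMap.adjoint_inner_right]

instance preInteriorCore : PreInnerProductSpace.Core ℂ (PreInterior 𝓑 E) where
  inner s t := interiorForm 𝓑 E s t
  conj_inner_symm s t := interiorForm_conj 𝓑 E s t
  re_inner_nonneg t := by
    obtain ⟨S, hS⟩ := TensorProduct.exists_finset (R := ℂ) (M := E) (N := H) t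
    have := gram_form_nonneg (𝓑 := 𝓑) (fun p : S => p.1.1) (fun p : S => p.1.2)
    have h2 : interiorForm 𝓑 E t t = ∑ p : S, ∑ q : S,
        ⟪p.1.2, (inn 𝓑 p.1.1 q.1.1 : H →L[ℂ] H) q.1.2⟫_ℂ := by
      rw [hS, ← Finset.sum_coe_sort S (fun p => p.1 ⊗ₜ[ℂ] p.2)]
      simp only [map_sum, LinearMap.sum_apply, interiorForm_tmul]
      exact Finset.sum_comm
    rw [h2]
    exact this
  add_left s t u := LinearMap.map_add₂ (interiorForm 𝓑 E) s t u
  smul_left s t c := LinearMap.map_smulₛₗ₂ (interiorForm 𝓑 E) c s t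

instance : SeminormedAddCommGroup (PreInterior 𝓑 E) :=
  InnerProductSpace.Core.toSeminormedAddCommGroup (𝕜 := ℂ)

instance : InnerProductSpace ℂ (PreInterior 𝓑 E) :=
  InnerProductSpace.ofCore (preInteriorCore 𝓑 E)

/-- The interior tensor product `E ⊙ H` of the Hilbert `𝓑`-module `E` with `H`: the Hausdorff
completion of the algebraic tensor product for the semi-inner product
`⟪x ⊗ h, y ⊗ k⟫ = ⟪h, ⟨x, y⟩ k⟫`. -/
abbrev Interior : Type _ := UniformSpace.Completion (PreInterior 𝓑 E)

variable {E}

theorem inner_preTmul (x y : E) (h k : H) :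
    ⟪preTmul 𝓑 x h, preTmul 𝓑 y k⟫_ℂ = ⟪h, (inn 𝓑 x y : H →L[ℂ] H) k⟫_ℂ := rfl

theorem norm_preTmul_le (x : E) (h : H) : ‖preTmul 𝓑 x h‖ ≤ ‖x‖ * ‖h‖ := by
  refine le_of_sq_le_sq ?_ (by positivity)
  rw [@norm_sq_eq_re_inner ℂ, inner_preTmul, mul_pow, HilbertModule.norm_sq_eq (𝓑 := 𝓑) x]
  calc RCLike.re ⟪h, (inn 𝓑 x x : H →L[ℂ] H) h⟫_ℂ
      ≤ ‖⟪h, (inn 𝓑 x x : H →L[ℂ] H) h⟫_ℂ‖ := RCLike.re_le_norm _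
    _ ≤ ‖h‖ * ‖(inn 𝓑 x x : H →L[ℂ] H) h‖ := norm_inner_le_norm _ _
    _ ≤ ‖h‖ * (‖(inn 𝓑 x x : H →L[ℂ] H)‖ * ‖h‖) := by
        gcongr
        exact ContinuousLinearMap.le_opNorm _ _
    _ = ‖(inn 𝓑 x x : H →L[ℂ] H)‖ * ‖h‖ ^ 2 := by ring

/-- The operator `L_x : H → E ⊙ H`, `h ↦ x ⊗ h`. -/
def creation (x : E) : H →L[ℂ] Interior 𝓑 E :=
  LinearMap.mkContinuous
    { toFun := fun h => (preTmul 𝓑 x h : Interior 𝓑 E)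
      map_add' := fun h k => by
        rw [← UniformSpace.Completion.coe_add]
        exact congrArg _ (TensorProduct.tmul_add x h k)
      map_smul' := fun c h => by
        rw [RingHom.id_apply, ← UniformSpace.Completion.coe_smul]
        exact congrArg _ (TensorProduct.tmul_smul c x h) }
    ‖x‖ fun h => by
      change ‖(preTmul 𝓑 x h : Interior 𝓑 E)‖ ≤ _
      rw [UniformSpace.Completion.norm_coe]
      exact norm_preTmul_le 𝓑 x h

variable (E) in
/-- `E` is a von Neumann `𝓑`-module: identified with `{L_x}`, it is strongly closed in the bounded
operators from `H` to `E ⊙ H`. -/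
def IsVonNeumannModule : Prop :=
  IsStronglyClosed (Set.range (creation 𝓑 (E := E)))

/-- A subset of `E`, identified with `{L_x}`, is strongly dense in `E`. -/
def IsStronglyDense (S : Set E) : Prop :=
  ∀ x : E, creation 𝓑 x ∈ strongClosure (creation 𝓑 '' S)

end Interior

/-! ### Direct sums and sub-bimodules -/

/-- The von Neumann algebra as a bimodule over itself, with `⟨a, b⟩ = a* b`. -/
instance instSelf (𝓑 : VonNeumannAlgebra H) : HilbertBimodule 𝓑 𝓑 where
  smul_complex_right z x b := mul_smul_comm z x b
  inn x y := star x * y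
  inn_self_nonneg x := star_mul_self_nonneg (x : H →L[ℂ] H)
  inn_self_eq_zero x h := (CStarRing.star_mul_self_eq_zero_iff x).1 h
  inn_smul_right x y b := (mul_assoc (star x) y b).symm
  star_inn x y := by rw [star_mul, star_star]
  inn_add_right x y z := mul_add _ _ _
  inn_smul_complex μ x y := mul_smul_comm _ _ _
  norm_sq_eq x := by rw [sq, CStarRing.norm_star_mul_self]
  smul_complex_left z b x := smul_mul_assoc z b x
  smul_left_right b c x := (mul_assoc b x c).symm
  inn_smul_left b x y := by
    change star (b * x) * y = star x * (star b * y)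
    rw [star_mul, mul_assoc]

/-- Norm closed sub-bimodules of a Hilbert bimodule. -/
structure SubBimodule (𝓑 : VonNeumannAlgebra H) (F : Type*) [NormedAddCommGroup F]
    [NormedSpace ℂ F] [HilbertBimodule 𝓑 F] extends Submodule ℂ F where
  smul_left_mem (b : 𝓑) {x : F} : x ∈ toSubmodule → b • x ∈ toSubmodule
  smul_right_mem (b : 𝓑) {x : F} : x ∈ toSubmodule → x <• b ∈ toSubmodule
  isClosed' : IsClosed (toSubmodule : Set F)

namespace SubBimodule

variable {𝓑 : VonNeumannAlgebra H} {F : Type*} [NormedAddCommGroup F]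
  [NormedSpace ℂ F] [HilbertBimodule 𝓑 F] (S : SubBimodule 𝓑 F)

instance [CompleteSpace F] : CompleteSpace S.toSubmodule := S.isClosed'.completeSpace_coe

/-- The restricted left action. -/
instance : Module (↥𝓑) S.toSubmodule where
  smul b x := ⟨b • (x : F), S.smul_left_mem b x.2⟩
  one_smul x := Subtype.ext (one_smul (↥𝓑) (x : F))
  mul_smul b c x := Subtype.ext (mul_smul b c (x : F))
  smul_zero b := Subtype.ext (smul_zero b)
  smul_add b x y := Subtype.ext (smul_add b (x : F) y)
  add_smul b c x := Subtype.ext (add_smul b c (x : F))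
  zero_smul x := Subtype.ext (zero_smul (↥𝓑) (x : F))

/-- The restricted right action. -/
instance : Module (↥𝓑)ᵐᵒᵖ S.toSubmodule where
  smul b x := ⟨b • (x : F), S.smul_right_mem b.unop x.2⟩
  one_smul x := Subtype.ext (one_smul (↥𝓑)ᵐᵒᵖ (x : F))
  mul_smul b c x := Subtype.ext (mul_smul b c (x : F))
  smul_zero b := Subtype.ext (smul_zero b)
  smul_add b x y := Subtype.ext (smul_add b (x : F) y)
  add_smul b c x := Subtype.ext (add_smul b c (x : F))
  zero_smul x := Subtype.ext (zero_smul (↥𝓑)ᵐᵒᵖ (x : F))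

/-- A closed sub-bimodule is a Hilbert bimodule with the restricted structure. -/
instance : HilbertBimodule 𝓑 S.toSubmodule where
  smul_complex_right z x b := Subtype.ext (HilbertModule.smul_complex_right z (x : F) b)
  inn x y := inn 𝓑 (x : F) (y : F)
  inn_self_nonneg x := HilbertModule.inn_self_nonneg (x : F)
  inn_self_eq_zero x h := Subtype.ext (HilbertModule.inn_self_eq_zero (x : F) h)
  inn_smul_right x y b := HilbertModule.inn_smul_right (x : F) (y : F) b
  star_inn x y := HilbertModule.star_inn (x : F) (y : F)
  inn_add_right x y z := HilbertModule.inn_add_right (x : F) (y : F) (z : F)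
  inn_smul_complex μ x y := HilbertModule.inn_smul_complex μ (x : F) (y : F)
  norm_sq_eq x := HilbertModule.norm_sq_eq (x : F)
  smul_complex_left z b x := Subtype.ext (HilbertBimodule.smul_complex_left z b (x : F))
  smul_left_right b c x := Subtype.ext (HilbertBimodule.smul_left_right b c (x : F))
  inn_smul_left b x y := HilbertBimodule.inn_smul_left b (x : F) (y : F)

end SubBimodule

/-- Isomorphisms `F ≅ E₁ ⊕ E₂` of Hilbert bimodules: two-sided linear bijections onto the direct
sum (componentwise operations) that preserve the inner product, where
`⟨(x₁, x₂), (y₁, y₂)⟩ = ⟨x₁, y₁⟩ + ⟨x₂, y₂⟩` on `E₁ ⊕ E₂`. -/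
structure DirectSumIso (𝓑 : VonNeumannAlgebra H) (F E₁ E₂ : Type*)
    [NormedAddCommGroup F] [NormedSpace ℂ F] [HilbertBimodule 𝓑 F]
    [NormedAddCommGroup E₁] [NormedSpace ℂ E₁] [HilbertBimodule 𝓑 E₁]
    [NormedAddCommGroup E₂] [NormedSpace ℂ E₂] [HilbertBimodule 𝓑 E₂]
    extends F ≃ₗ[ℂ] E₁ × E₂ where
  map_smul_left (b : 𝓑) (x : F) : toFun (b • x) = b • toFun x
  map_smul_right (b : 𝓑) (x : F) : toFun (x <• b) = toFun x <• b
  map_inn (x y : F) :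
    inn 𝓑 x y = inn 𝓑 (toFun x).1 (toFun y).1 + inn 𝓑 (toFun x).2 (toFun y).2

/-! ### Kernels -/

section Kernels

variable {𝓑 : VonNeumannAlgebra H} {Ω : Type*}

/-- A kernel of bounded linear maps `K σ σ' : 𝓑 → 𝓑` is completely positive definite (CPD) if
`∑ᵢⱼ cᵢ* K^{σᵢ,σⱼ}(bᵢ* bⱼ) cⱼ ≥ 0` for all finite families. -/
def IsCPD (K : Ω → Ω → (𝓑 →L[ℂ] 𝓑)) : Prop :=
  ∀ (n : ℕ) (σ : Fin n → Ω) (b c : Fin n → 𝓑),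
    0 ≤ ((∑ k, ∑ l, star (c k) * K (σ k) (σ l) (star (b k) * b l) * c l : 𝓑) : H →L[ℂ] H)

/-- The kernel `(σ, σ') ↦ (x ↦ (b σ)* x (b σ'))`. -/
def conjKernel (b : Ω → 𝓑) (σ σ' : Ω) : 𝓑 →L[ℂ] 𝓑 :=
  ContinuousLinearMap.mulLeftRight ℂ 𝓑 (star (b σ)) (b σ')

theorem conjKernel_apply (b : Ω → 𝓑) (σ σ' : Ω) (x : 𝓑) :
    conjKernel b σ σ' x = star (b σ) * x * b σ' := rfl

/-- The strongly closed two-sided ideal of `𝓑` generated by a set: the smallest two-sided ideal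
that contains the set and is strongly closed. -/
def strongIdealSpan (s : Set 𝓑) : TwoSidedIdeal 𝓑 :=
  sInf {I : TwoSidedIdeal 𝓑 | s ⊆ (I : Set 𝓑) ∧
    IsStronglyClosed ((fun x : 𝓑 => (x : H →L[ℂ] H)) '' (I : Set 𝓑))}

/-- `(F, i)` is a minimal Kolmogorov decomposition of `K`: `F` is a von Neumann module (with left
action of `𝓑`), `K σ σ' b = ⟨i σ, b (i σ')⟩`, and the span of the elements `b (i σ) c` is strongly
dense in `F`. -/
structure IsMinimalKolmogorov {F : Type*} [NormedAddCommGroup F] [NormedSpace ℂ F]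
    [HilbertBimodule 𝓑 F] (K : Ω → Ω → (𝓑 →L[ℂ] 𝓑)) (i : Ω → F) : Prop where
  isVonNeumannModule : IsVonNeumannModule 𝓑 F
  kernel_eq (σ σ' : Ω) (b : 𝓑) : K σ σ' b = inn 𝓑 (i σ) (b • i σ')
  dense : IsStronglyDense 𝓑
    (Submodule.span ℂ {x : F | ∃ (b : 𝓑) (σ : Ω) (c : 𝓑), x = (b • i σ) <• c} : Set F)

/-- The center of a Hilbert bimodule: the elements `f` with `b f = f b` for all `b`. -/
def center (𝓑 : VonNeumannAlgebra H) (F : Type*) [NormedAddCommGroup F] [NormedSpace ℂ F]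
    [HilbertBimodule 𝓑 F] : Set F :=
  {f | ∀ b : 𝓑, b • f = f <• b}

end Kernels

end VNKernel

end

open scoped TensorProduct RightActions InnerProductSpace

namespace VNKernel

/-! ### Strong closures as pointwise closures. -/

section StrongClosure

variable {H K : Type*} [NormedAddCommGroup H] [NormedSpace ℂ H]
  [NormedAddCommGroup K] [NormedSpace ℂ K]

/-! A central unit vector `ζ` yields the projection `f ↦ ζ⟨ζ, f⟩`, which is two-sided linear. Its
range is a copy of `𝓑` and its kernel is the complement `F'`. Conversely, the vector corresponding
to `(1, 0)` in `𝓑 ⊕ F'` is a central unit. In terms of kernels, put `b^σ = ⟨ζ, i(σ)⟩`; then `L` is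
the kernel of the components `i(σ) - ζ b^σ`, and the ideal generated by the `b^σ` is strongly dense
because `1 = ⟨ζ, ζ⟩` is a strong limit of elements `⟨ζ, x⟩` with `x` in the span of the `b i(σ) c`.

The substantial direction is from (iii) back to (i). Since `K` dominates the kernel of the `b^σ`,
the rule `d i(σ) ⊗ h ↦ d b^σ h` defines a contraction `V : F ⊗ H → H` with `V L_x ∈ 𝓑`. Self-duality
of von Neumann modules (`IsVonNeumannModule.exists_creation_eq`) gives `V* = L_ζ`, that is, `⟨ζ, d
i(σ)⟩ = d b^σ` (`IsMinimalKolmogorov.exists_vector`). This `ζ` is central but need not be a unit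
vector. The ideal condition makes `⟨ζ, ζ⟩` injective (`eq_zero_of_inn_self_apply`), and the polar
decomposition `ζ = ξ ⟨ζ, ζ⟩^{1/2}` then supplies a central unit `ξ`
(`IsVonNeumannModule.exists_central_unit`). -/

theorem mem_strongClosure_iff {S : Set (H →L[ℂ] K)} {T : H →L[ℂ] K} :
    T ∈ strongClosure S ↔ (T : H → K) ∈ closure ((fun A : H →L[ℂ] K => (A : H → K)) '' S) := by
  have hind := (PointwiseConvergenceCLM.isEmbedding_coeFn (RingHom.id ℂ) H K).isInducing
  rw [strongClosure, Set.mem_preimage, hind.closure_eq_preimage_closure_image, Set.mem_preimage,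
    Set.image_image]
  rfl

theorem isStronglyClosed_iff {S : Set (H →L[ℂ] K)} :
    IsStronglyClosed S ↔ strongClosure S ⊆ S := by
  rw [IsStronglyClosed, ← closure_subset_iff_isClosed, strongClosure]
  constructor
  · rintro h T hT
    obtain ⟨A, hA, hAT⟩ := h hT
    have : A = T := hAT
    exact this ▸ hA
  · intro h T hT
    exact ⟨T, h hT, rfl⟩

/-- Pointwise closed conditions pass to the strong closure. -/
theorem strongClosure_induction {S : Set (H →L[ℂ] K)} {p : (H → K) → Prop}
    (hp : IsClosed {f | p f}) (hS : ∀ A ∈ S, p A) {T : H →L[ℂ] K} (hT : T ∈ strongClosure S) :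
    p T := by
  have h : closure ((fun A : H →L[ℂ] K => (A : H → K)) '' S) ⊆ {f | p f} :=
    closure_minimal (by rintro _ ⟨A, hA, rfl⟩; exact hS A hA) hp
  exact h (mem_strongClosure_iff.1 hT)

theorem mem_strongClosure_of_approx {S : Set (H →L[ℂ] K)} {T : H →L[ℂ] K}
    (h : ∀ (s : Finset H) (ε : ℝ), 0 < ε → ∃ A ∈ S, ∀ v ∈ s, ‖A v - T v‖ < ε) :
    T ∈ strongClosure S := by
  rw [mem_strongClosure_iff, mem_closure_iff_nhds]
  intro U hU
  rw [nhds_pi, Filter.mem_pi] at hU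
  obtain ⟨I, hI, t, ht, hsub⟩ := hU
  have : ∀ v, ∃ ε > 0, Metric.ball (T v) ε ⊆ t v := fun v => Metric.mem_nhds_iff.1 (ht v)
  choose ε hε hball using this
  obtain ⟨δ, hδ, hle⟩ : ∃ δ > 0, ∀ v ∈ hI.toFinset, δ ≤ ε v := by
    classical
    clear hsub hball
    induction hI.toFinset using Finset.induction_on with
    | empty => exact ⟨1, one_pos, by simp⟩
    | insert a s _ ih =>
      obtain ⟨δ, hδ, h⟩ := ih
      refine ⟨min δ (ε a), lt_min hδ (hε a), fun v hv => ?_⟩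
      rcases Finset.mem_insert.1 hv with rfl | hv
      · exact min_le_right _ _
      · exact (min_le_left _ _).trans (h v hv)
  obtain ⟨A, hA, hAT⟩ := h hI.toFinset δ hδ
  refine ⟨A, hsub fun v hv => hball v ?_, A, hA, rfl⟩
  have hv' : v ∈ hI.toFinset := hI.mem_toFinset.2 hv
  rw [Metric.mem_ball, dist_eq_norm]
  exact (hAT v hv').trans_le (hle v hv')

end StrongClosure

variable {H : Type*} [NormedAddCommGroup H] [InnerProductSpace ℂ H] [CompleteSpace H]

/-- The bicommutant theorem, in pointwise form. -/
theorem mem_of_forall_commutant {𝓑 : VonNeumannAlgebra H} {T : H →L[ℂ] H}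
    (h : ∀ b' ∈ 𝓑.commutant, ∀ v, b' (T v) = T (b' v)) : T ∈ 𝓑 := by
  rw [← 𝓑.commutant_commutant, VonNeumannAlgebra.mem_commutant_iff]
  intro b' hb'
  ext v
  exact h b' hb' v

theorem commutant_apply {𝓑 : VonNeumannAlgebra H} {b b' : H →L[ℂ] H} (hb : b ∈ 𝓑)
    (hb' : b' ∈ 𝓑.commutant) (v : H) : b' (b v) = b (b' v) := by
  have := VonNeumannAlgebra.mem_commutant_iff.1 hb' b hb
  exact (congrArg (fun A : H →L[ℂ] H => A v) this).symm

theorem coe_sum_vn {𝓑 : VonNeumannAlgebra H} {ι : Type*} (s : Finset ι) (f : ι → 𝓑) :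
    ((∑ m ∈ s, f m : 𝓑) : H →L[ℂ] H) = ∑ m ∈ s, (f m : H →L[ℂ] H) :=
  map_sum (SubringClass.subtype 𝓑) f s

/-! ### The operators `L_x` and self-duality. -/

section Creation

variable {𝓑 : VonNeumannAlgebra H} {E : Type*} [NormedAddCommGroup E] [NormedSpace ℂ E]
  [HilbertModule 𝓑 E]

theorem inner_creation (x y : E) (h k : H) :
    ⟪creation 𝓑 x h, creation 𝓑 y k⟫_ℂ = ⟪h, (inn 𝓑 x y : H →L[ℂ] H) k⟫_ℂ := by
  change ⟪(preTmul 𝓑 x h : Interior 𝓑 E), (preTmul 𝓑 y k : Interior 𝓑 E)⟫_ℂ = _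
  rw [UniformSpace.Completion.inner_coe, inner_preTmul]

theorem dense_span_creation :
    Dense (Submodule.span ℂ {u : Interior 𝓑 E | ∃ (x : E) (h : H), u = creation 𝓑 x h} :
      Set (Interior 𝓑 E)) := by
  intro u
  induction u using UniformSpace.Completion.induction_on with
  | hp => exact isClosed_closure
  | ih t =>
    apply subset_closure
    induction t using TensorProduct.induction_on with
    | zero =>
      have : ((0 : PreInterior 𝓑 E) : Interior 𝓑 E) = 0 := UniformSpace.Completion.coe_zero
      exact this ▸ Submodule.zero_mem _
    | tmul x h => exact Submodule.subset_span ⟨x, h, rfl⟩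
    | add s t hs ht =>
      have := UniformSpace.Completion.coe_add (α := PreInterior 𝓑 E) s t
      exact this ▸ Submodule.add_mem _ hs ht

theorem eq_zero_of_inner_creation {u : Interior 𝓑 E}
    (hu : ∀ (y : E) (k : H), ⟪creation 𝓑 y k, u⟫_ℂ = 0) : u = 0 := by
  refine dense_span_creation.eq_zero_of_inner_left (𝕜 := ℂ) (fun v hv => ?_)
  induction hv using Submodule.span_induction with
  | mem v hv => obtain ⟨y, k, rfl⟩ := hv; rw [← inner_conj_symm, hu, map_zero]
  | zero => simp
  | add v w _ _ hv hw => rw [inner_add_right, hv, hw, add_zero]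
  | smul c v _ hv => rw [inner_smul_right, hv, mul_zero]

theorem ext_inner_creation {u v : Interior 𝓑 E}
    (h : ∀ (y : E) (k : H), ⟪creation 𝓑 y k, u⟫_ℂ = ⟪creation 𝓑 y k, v⟫_ℂ) : u = v :=
  sub_eq_zero.1 (eq_zero_of_inner_creation fun y k => by rw [inner_sub_right, h, sub_self])

theorem creation_add (x y : E) : creation 𝓑 (x + y) = creation 𝓑 x + creation 𝓑 y := by
  ext h
  refine ext_inner_creation fun z k => ?_
  rw [add_apply, inner_add_right, inner_creation, inner_creation,
    inner_creation, inn_add_right]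
  exact inner_add_right _ _ _

theorem creation_smul (c : ℂ) (x : E) : creation 𝓑 (c • x) = c • creation 𝓑 x := by
  ext h
  refine ext_inner_creation fun z k => ?_
  rw [smul_apply, inner_smul_right, inner_creation,
    inner_creation, inn_smul_complex]
  exact inner_smul_right _ _ _

theorem creation_smul_right (x : E) (b : 𝓑) (h : H) :
    creation 𝓑 (x <• b) h = creation 𝓑 x ((b : H →L[ℂ] H) h) := by
  refine ext_inner_creation fun z k => ?_
  rw [inner_creation, inner_creation, inn_smul_right]
  rfl

variable (𝓑 E) in
/-- `x ↦ L_x` as a linear map. -/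
noncomputable def creationHom : E →ₗ[ℂ] (H →L[ℂ] Interior 𝓑 E) where
  toFun := creation 𝓑
  map_add' := creation_add
  map_smul' := creation_smul

theorem adjoint_creation_comp (x y : E) (h : H) :
    ContinuousLinearMap.adjoint (creation 𝓑 x) (creation 𝓑 y h) = (inn 𝓑 x y : H →L[ℂ] H) h := by
  refine ext_inner_left ℂ fun k => ?_
  rw [ContinuousLinearMap.adjoint_inner_right, inner_creation]

theorem creation_injective : Function.Injective (creation 𝓑 : E → (H →L[ℂ] Interior 𝓑 E)) := by
  refine (injective_iff_map_eq_zero (creationHom 𝓑 E)).2 fun x hx => ?_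
  have hx : creation 𝓑 x = 0 := hx
  apply HilbertModule.inn_self_eq_zero (𝓑 := 𝓑)
  ext h
  change (inn 𝓑 x x : H →L[ℂ] H) h = 0
  rw [← adjoint_creation_comp, hx]
  simp

/-- Self-duality of von Neumann modules. -/
theorem IsVonNeumannModule.exists_creation_eq (hE : IsVonNeumannModule 𝓑 E)
    (T : H →L[ℂ] Interior 𝓑 E)
    (hT : ∀ y : E, ContinuousLinearMap.adjoint (creation 𝓑 y) ∘L T ∈ 𝓑) :
    ∃ x : E, creation 𝓑 x = T := by
  refine isStronglyClosed_iff.1 hE (mem_strongClosure_of_approx fun s ε hε => ?_)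
  -- Approximating `T` on the finite set `s` means that the tuple `(T v)_v` lies in the closure of
  -- the subspace `M` of tuples `(L_x v)_v`. The component `r` of `ev T` orthogonal to `M` is shown
  -- to vanish.
  let ev : (H →L[ℂ] Interior 𝓑 E) →ₗ[ℂ] PiLp 2 (fun _ : s => Interior 𝓑 E) :=
    { toFun := fun A => WithLp.toLp 2 fun v => A v.1
      map_add' := fun A B => rfl
      map_smul' := fun c A => rfl }
  let M : Submodule ℂ (PiLp 2 (fun _ : s => Interior 𝓑 E)) :=
    LinearMap.range (ev ∘ₗ creationHom 𝓑 E)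
  have hM : ∀ x, ev (creation 𝓑 x) ∈ M := fun x => ⟨x, rfl⟩
  -- The operators `L_w L_w*` are self-adjoint, preserve `M` because `L_w L_w* L_x = L_{w⟨w, x⟩}`,
  -- and send `ev T` into `M` because `L_w* T ∈ 𝓑`.
  let A : E → Interior 𝓑 E →L[ℂ] Interior 𝓑 E :=
    fun w => creation 𝓑 w ∘L ContinuousLinearMap.adjoint (creation 𝓑 w)
  have hAx : ∀ w x, ∃ y, ∀ v, A w (creation 𝓑 x v) = creation 𝓑 y v := fun w x =>
    ⟨w <• inn 𝓑 w x, fun v => by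
      rw [creation_smul_right, ← adjoint_creation_comp]; rfl⟩
  have hAT : ∀ w, ∃ y, ∀ v, A w (T v) = creation 𝓑 y v := fun w =>
    ⟨w <• (⟨_, hT w⟩ : 𝓑), fun v => by rw [creation_smul_right]; rfl⟩
  let A' : E → PiLp 2 (fun _ : s => Interior 𝓑 E) →L[ℂ] PiLp 2 (fun _ : s => Interior 𝓑 E) :=
    fun w => (PiLp.continuousLinearEquiv 2 ℂ (fun _ : s => Interior 𝓑 E)).symm.toContinuousLinearMap
      ∘L ContinuousLinearMap.pi (fun v => A w ∘L PiLp.proj 2 _ v)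
  have hA' : ∀ w t v, A' w t v = A w (t v) := fun w t v => rfl
  have hA'M : ∀ w t, t ∈ M → A' w t ∈ M := by
    rintro w _ ⟨x, rfl⟩
    obtain ⟨y, hy⟩ := hAx w x
    have : A' w (ev (creation 𝓑 x)) = ev (creation 𝓑 y) := by
      ext v; exact hy v
    exact this ▸ hM y
  have hsymm : ∀ w u v, ⟪A w u, v⟫_ℂ = ⟪u, A w v⟫_ℂ := fun w u v => by
    simp only [A, ContinuousLinearMap.comp_apply]
    rw [← ContinuousLinearMap.adjoint_inner_right, ContinuousLinearMap.adjoint_inner_left]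
  obtain ⟨y, hy, r, hr, htr⟩ :=
    (M.topologicalClosure).exists_add_mem_mem_orthogonal (ev T)
  -- `r` is the difference of `ev T` and a point of the closure of `M`, so its image is in that
  -- closure; by self-adjointness the image is also orthogonal to it.
  have hA'r : ∀ w, A' w r = 0 := by
    intro w
    have h1 : A' w r ∈ M.topologicalClosure := by
      have : r = ev T - y := by rw [htr, add_sub_cancel_left]
      rw [this, map_sub]
      refine Submodule.sub_mem _ (M.le_topologicalClosure ?_) ?_
      · obtain ⟨x, hx⟩ := hAT w
        have : A' w (ev T) = ev (creation 𝓑 x) := by ext v; exact hx v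
        exact this ▸ hM x
      · exact map_mem_closure (A' w).continuous hy (hA'M w)
    have h2 : A' w r ∈ M.topologicalClosureᗮ := by
      rw [Submodule.orthogonal_closure, Submodule.mem_orthogonal] at *
      intro u hu
      have := hr _ (hA'M w u hu)
      rw [PiLp.inner_apply] at this ⊢
      rw [← this]
      exact Finset.sum_congr rfl fun v _ => by rw [hA', hA', hsymm]
    exact Submodule.disjoint_def.1 (Submodule.orthogonal_disjoint _) _ h1 h2
  have hr0 : r = 0 := by
    ext v
    refine eq_zero_of_inner_creation fun w k => ?_
    have h1 : A w (r v) = 0 := by rw [← hA', hA'r]; rfl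
    -- `‖L_w* r_v‖² = ⟪r_v, L_w L_w* r_v⟫ = 0`.
    have h2 : ContinuousLinearMap.adjoint (creation 𝓑 w) (r v) = 0 := by
      rw [← inner_self_eq_zero (𝕜 := ℂ), ContinuousLinearMap.adjoint_inner_left]
      change ⟪r v, A w (r v)⟫_ℂ = 0
      rw [h1, inner_zero_right]
    rw [← ContinuousLinearMap.adjoint_inner_right, h2, inner_zero_right]
  rw [hr0, add_zero] at htr
  rw [← htr] at hy
  obtain ⟨_, ⟨x, rfl⟩, hx⟩ := Metric.mem_closure_iff.1 hy ε hε
  refine ⟨creation 𝓑 x, ⟨x, rfl⟩, fun v hv => ?_⟩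
  rw [dist_comm, dist_eq_norm] at hx
  exact (PiLp.norm_apply_le (ev (creation 𝓑 x) - ev T) ⟨v, hv⟩).trans_lt hx

end Creation

end VNKernel

namespace VNKernel

/-! ### Bounded operators defined on total families. -/

section Extension

variable {J K₁ K₂ : Type*} [NormedAddCommGroup K₁] [InnerProductSpace ℂ K₁]
  [NormedAddCommGroup K₂] [InnerProductSpace ℂ K₂] [CompleteSpace K₂]

/-- A family dominated by a total family is its image under a bounded operator. -/
theorem exists_clm_of_norm_le {u : J → K₁} {w : J → K₂}
    (hu : Dense (Submodule.span ℂ (Set.range u) : Set K₁))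
    (h : ∀ g : J →₀ ℂ,
      ‖Finsupp.linearCombination ℂ w g‖ ≤ ‖Finsupp.linearCombination ℂ u g‖) :
    ∃ V : K₁ →L[ℂ] K₂, ∀ j, V (u j) = w j := by
  have hd : DenseRange (Finsupp.linearCombination ℂ u) := by
    rw [← Finsupp.range_linearCombination] at hu
    exact hu
  refine ⟨(Finsupp.linearCombination ℂ w).extendOfNorm (Finsupp.linearCombination ℂ u),
    fun j => ?_⟩
  have := LinearMap.extendOfNorm_eq (f := Finsupp.linearCombination ℂ w) hd ⟨1, fun g => by rw [one_mul]; exact h g⟩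
    (Finsupp.single j (1 : ℂ))
  simpa using this

/-- Two families with the same Gram matrix are related by an isometry. -/
theorem exists_isometry_of_inner_eq {u : J → K₁} {w : J → K₂}
    (hu : Dense (Submodule.span ℂ (Set.range u) : Set K₁))
    (h : ∀ j l, ⟪w j, w l⟫_ℂ = ⟪u j, u l⟫_ℂ) :
    ∃ V : K₁ →L[ℂ] K₂, (∀ j, V (u j) = w j) ∧ ∀ x, ‖V x‖ = ‖x‖ := by
  have hn : ∀ g : J →₀ ℂ,
      ‖Finsupp.linearCombination ℂ w g‖ = ‖Finsupp.linearCombination ℂ u g‖ := by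
    intro g
    rw [← sq_eq_sq₀ (norm_nonneg _) (norm_nonneg _), @norm_sq_eq_re_inner ℂ,
      @norm_sq_eq_re_inner ℂ]
    simp only [Finsupp.linearCombination_apply, Finsupp.sum, sum_inner, inner_sum,
      inner_smul_left, inner_smul_right, h]
  obtain ⟨V, hV⟩ := exists_clm_of_norm_le hu fun g => (hn g).le
  refine ⟨V, hV, fun x => ?_⟩
  refine hu.induction (P := fun x => ‖V x‖ = ‖x‖) (fun x hx => ?_)
    (isClosed_eq (by fun_prop) (by fun_prop)) x
  rw [SetLike.mem_coe, ← Finsupp.range_linearCombination] at hx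
  obtain ⟨g, rfl⟩ := hx
  rw [← hn, Finsupp.linearCombination_apply, Finsupp.linearCombination_apply, Finsupp.sum,
    Finsupp.sum, map_sum]
  simp only [map_smul, hV]

end Extension

theorem comp_mem_strongClosure {H K K' : Type*} [NormedAddCommGroup H] [NormedSpace ℂ H]
    [NormedAddCommGroup K] [NormedSpace ℂ K] [NormedAddCommGroup K'] [NormedSpace ℂ K']
    {S : Set (H →L[ℂ] K)} {S' : Set (H →L[ℂ] K')} (V : K →L[ℂ] K')
    (hV : ∀ A ∈ S, V ∘L A ∈ S') {T : H →L[ℂ] K} (hT : T ∈ strongClosure S) :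
    V ∘L T ∈ strongClosure S' := by
  rw [mem_strongClosure_iff]
  refine strongClosure_induction
    (p := fun f => V ∘ f ∈ closure ((fun A : H →L[ℂ] K' => (A : H → K')) '' S')) ?_
    (fun A hA => subset_closure ⟨V ∘L A, hV A hA, rfl⟩) hT
  refine isClosed_closure.preimage ?_
  exact continuous_pi fun v => V.continuous.comp (continuous_apply v)

variable {H : Type*} [NormedAddCommGroup H] [InnerProductSpace ℂ H] [CompleteSpace H]
  {𝓑 : VonNeumannAlgebra H}

/-! ### Inner products under norm and strong limits. -/

section Module

variable {E : Type*} [NormedAddCommGroup E] [NormedSpace ℂ E] [HilbertModule 𝓑 E]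

theorem inn_sub_right (x y z : E) : inn 𝓑 x (y - z) = inn 𝓑 x y - inn 𝓑 x z :=
  map_sub (innHom 𝓑 x) y z

theorem inn_sub_left (x y z : E) : inn 𝓑 (x - y) z = inn 𝓑 x z - inn 𝓑 y z :=
  map_sub ((innHom 𝓑).flip z) x y

theorem continuous_creation_apply (h : H) : Continuous fun x : E => creation 𝓑 x h := by
  refine AddMonoidHomClass.continuous_of_bound
    ((LinearMap.applyₗ h ∘ₗ ContinuousLinearMap.coeLM ℂ) ∘ₗ creationHom 𝓑 E) ‖h‖ fun x => ?_
  change ‖(preTmul 𝓑 x h : Interior 𝓑 E)‖ ≤ _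
  rw [UniformSpace.Completion.norm_coe, mul_comm]
  exact norm_preTmul_le 𝓑 x h

/-- Testing on vectors, `⟨z, x⟩ h = L_z* (x ⊗ h)`, and `x ↦ x ⊗ h` is norm continuous; no
Cauchy–Schwarz inequality for the `𝓑`-valued product is needed. -/
theorem isClosed_inn_eq_zero (z : E) : IsClosed {x : E | inn 𝓑 z x = 0} := by
  have : {x : E | inn 𝓑 z x = 0}
      = ⋂ h : H, {x : E | ContinuousLinearMap.adjoint (creation 𝓑 z) (creation 𝓑 x h) = 0} := by
    ext x
    simp only [Set.mem_ofPred_eq, Set.mem_iInter, adjoint_creation_comp]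
    constructor
    · intro h k; rw [h]; rfl
    · intro h; ext k; exact h k
  rw [this]
  exact isClosed_iInter fun h => isClosed_eq
    ((ContinuousLinearMap.continuous _).comp (continuous_creation_apply h)) continuous_const

theorem inn_eq_zero_of_mem_strongClosure {S : Set E} {z x : E}
    (hx : creation 𝓑 x ∈ strongClosure (creation 𝓑 '' S)) (hS : ∀ y ∈ S, inn 𝓑 z y = 0) :
    inn 𝓑 z x = 0 := by
  ext h
  change (inn 𝓑 z x : H →L[ℂ] H) h = 0
  rw [← adjoint_creation_comp]
  refine strongClosure_induction
    (p := fun f => ContinuousLinearMap.adjoint (creation 𝓑 z) (f h) = 0) ?_ ?_ hx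
  · exact isClosed_eq (by fun_prop) continuous_const
  · rintro _ ⟨y, hy, rfl⟩
    rw [adjoint_creation_comp, hS y hy]
    rfl

end Module

/-! ### Central vectors and direct summands. -/

section Bimodule

variable {F : Type*} [NormedAddCommGroup F] [NormedSpace ℂ F] [HilbertBimodule 𝓑 F]

theorem inn_smul_left (b : 𝓑) (x y : F) : inn 𝓑 (b • x) y = inn 𝓑 x (star b • y) :=
  HilbertBimodule.inn_smul_left b x y

theorem smul_left_right (b c : 𝓑) (x : F) : b • (x <• c) = (b • x) <• c :=
  HilbertBimodule.smul_left_right b c x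

theorem inn_center_smul {ζ : F} (hζ : ζ ∈ center 𝓑 F) (b : 𝓑) (y : F) :
    inn 𝓑 ζ (b • y) = b * inn 𝓑 ζ y := by
  conv_lhs => rw [← star_star b, ← inn_smul_left, hζ (star b), inn_smul_right_left, star_star]

/-- The complement of a central vector, as a sub-bimodule. -/
noncomputable def centralComplement (ζ : F) (hζ : ζ ∈ center 𝓑 F) : SubBimodule 𝓑 F where
  carrier := {f | inn 𝓑 ζ f = 0}
  add_mem' {x y} hx hy := by
    rw [Set.mem_ofPred_eq] at *
    rw [inn_add_right, hx, hy, add_zero]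
  zero_mem' := map_zero (innHom 𝓑 ζ)
  smul_mem' c x hx := by
    rw [Set.mem_ofPred_eq] at *
    rw [inn_smul_complex, hx, smul_zero]
  smul_left_mem b x hx := by
    change inn 𝓑 ζ x = 0 at hx
    change inn 𝓑 ζ (b • x) = 0
    rw [inn_center_smul hζ, hx, mul_zero]
  smul_right_mem b x hx := by
    change inn 𝓑 ζ x = 0 at hx
    change inn 𝓑 ζ (x <• b) = 0
    rw [inn_smul_right, hx, zero_mul]
  isClosed' := isClosed_inn_eq_zero ζ

theorem mem_centralComplement {ζ : F} {hζ : ζ ∈ center 𝓑 F} {f : F} :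
    f ∈ (centralComplement ζ hζ).toSubmodule ↔ inn 𝓑 ζ f = 0 := Iff.rfl

/-- `F' ⊗ H` and `F ⊗ H` are different completions, so strong limits are moved along the isometry `V
: x ⊗ h ↦ x ⊗ h`. A limit `T` becomes `V T = L_x` with `x ∈ F`; orthogonality to `ζ` survives the
limit, so `x ∈ F'`, and injectivity of `V` returns `T = L_x`. -/
theorem isVonNeumannModule_centralComplement (hF : IsVonNeumannModule 𝓑 F) (ζ : F)
    (hζ : ζ ∈ center 𝓑 F) :
    IsVonNeumannModule 𝓑 (centralComplement ζ hζ).toSubmodule := by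
  set F' := (centralComplement ζ hζ).toSubmodule
  refine isStronglyClosed_iff.2 fun T hT => ?_
  have hd : Dense (Submodule.span ℂ (Set.range fun j : F' × H => creation 𝓑 j.1 j.2) :
      Set (Interior 𝓑 F')) := by
    convert dense_span_creation (𝓑 := 𝓑) (E := F') using 3
    ext u
    constructor
    · rintro ⟨j, rfl⟩; exact ⟨j.1, j.2, rfl⟩
    · rintro ⟨x, h, rfl⟩; exact ⟨(x, h), rfl⟩
  obtain ⟨V, hV, hVn⟩ := exists_isometry_of_inner_eq
    (w := fun j : F' × H => creation 𝓑 (j.1 : F) j.2) hd fun j l => by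
      rw [inner_creation, inner_creation]; rfl
  have hVc : ∀ x : F', V ∘L creation 𝓑 x = creation 𝓑 (x : F) := fun x => by
    ext h; exact hV (x, h)
  have h1 : V ∘L T ∈ strongClosure (creation 𝓑 '' {f : F | inn 𝓑 ζ f = 0}) := by
    refine comp_mem_strongClosure V ?_ hT
    rintro _ ⟨x, rfl⟩
    exact ⟨x, x.2, (hVc x).symm⟩
  obtain ⟨x, hx⟩ : V ∘L T ∈ Set.range (creation 𝓑 (E := F)) := by
    refine isStronglyClosed_iff.1 hF ?_
    refine comp_mem_strongClosure V ?_ hT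
    rintro _ ⟨x, rfl⟩
    exact ⟨x, (hVc x).symm⟩
  rw [← hx] at h1
  have hx0 : inn 𝓑 ζ x = 0 := inn_eq_zero_of_mem_strongClosure h1 fun y hy => hy
  refine ⟨⟨x, hx0⟩, ?_⟩
  ext h
  rw [← sub_eq_zero, ← norm_eq_zero, ← hVn, map_sub]
  have h2 := DFunLike.congr_fun (hVc ⟨x, hx0⟩) h
  have h3 := DFunLike.congr_fun hx h
  rw [ContinuousLinearMap.comp_apply] at h2 h3
  rw [h2, h3, sub_self, norm_zero]

/-- A central unit vector splits off a copy of `𝓑`. -/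
noncomputable def centralSplitting (ζ : F) (hζ : ζ ∈ center 𝓑 F) (h1 : inn 𝓑 ζ ζ = 1) :
    DirectSumIso 𝓑 F 𝓑 (centralComplement ζ hζ).toSubmodule where
  toFun f := (inn 𝓑 ζ f, ⟨f - ζ <• inn 𝓑 ζ f, mem_centralComplement.2 <| by
    rw [inn_sub_right, inn_smul_right, h1, one_mul, sub_self]⟩)
  invFun p := ζ <• p.1 + p.2
  map_add' x y := by
    refine Prod.ext (inn_add_right _ _ _) (Subtype.ext ?_)
    change x + y - ζ <• inn 𝓑 ζ (x + y) = (x - ζ <• inn 𝓑 ζ x) + (y - ζ <• inn 𝓑 ζ y)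
    rw [inn_add_right, MulOpposite.op_add, add_smul]
    abel
  map_smul' c x := by
    refine Prod.ext (inn_smul_complex _ _ _) (Subtype.ext ?_)
    change c • x - ζ <• inn 𝓑 ζ (c • x) = c • (x - ζ <• inn 𝓑 ζ x)
    rw [inn_smul_complex, HilbertModule.smul_complex_right, smul_sub]
  left_inv x := add_sub_cancel _ _
  right_inv p := by
    have h2 : inn 𝓑 ζ (p.2 : F) = 0 := p.2.2
    have h3 : inn 𝓑 ζ (ζ <• p.1 + p.2) = p.1 := by
      rw [inn_add_right, inn_smul_right, h1, h2, one_mul, add_zero]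
    refine Prod.ext h3 (Subtype.ext ?_)
    change ζ <• p.1 + p.2 - ζ <• inn 𝓑 ζ (ζ <• p.1 + p.2) = p.2
    rw [h3, add_sub_cancel_left]
  map_smul_left b x := by
    refine Prod.ext (inn_center_smul hζ b x) (Subtype.ext ?_)
    change b • x - ζ <• inn 𝓑 ζ (b • x) = b • (x - ζ <• inn 𝓑 ζ x)
    rw [inn_center_smul hζ, smul_sub, smul_left_right, hζ, MulOpposite.op_mul, mul_smul]
  map_smul_right b x := by
    refine Prod.ext (inn_smul_right _ _ _) (Subtype.ext ?_)
    change x <• b - ζ <• inn 𝓑 ζ (x <• b) = (x - ζ <• inn 𝓑 ζ x) <• b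
    rw [inn_smul_right, smul_sub, MulOpposite.op_mul, mul_smul]
  map_inn x y := by
    change inn 𝓑 x y = star (inn 𝓑 ζ x) * inn 𝓑 ζ y
      + inn 𝓑 (x - ζ <• inn 𝓑 ζ x) (y - ζ <• inn 𝓑 ζ y)
    rw [inn_sub_right, inn_sub_left, inn_sub_left, inn_smul_right, inn_smul_right,
      inn_smul_right_left, inn_smul_right_left, h1, mul_one, star_inn]
    abel

theorem DirectSumIso.exists_central_unit {F' : Type*} [NormedAddCommGroup F'] [NormedSpace ℂ F']
    [HilbertBimodule 𝓑 F'] (e : DirectSumIso 𝓑 F 𝓑 F') : ∃ ζ ∈ center 𝓑 F, inn 𝓑 ζ ζ = 1 := by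
  obtain ⟨ζ, hζ⟩ := e.toLinearEquiv.surjective (1, 0)
  have hζ' : e.toFun ζ = (1, 0) := hζ
  refine ⟨ζ, fun b => e.toLinearEquiv.injective ?_, ?_⟩
  · refine (e.map_smul_left b ζ).trans (Eq.trans ?_ (e.map_smul_right b ζ).symm)
    rw [hζ']
    refine Prod.ext ?_ ?_
    · exact (mul_one b).trans (one_mul b).symm
    · exact (smul_zero b).trans (smul_zero (MulOpposite.op b)).symm
  · rw [e.map_inn, hζ']
    change star (1 : 𝓑) * 1 + innHom 𝓑 0 0 = 1
    rw [star_one, mul_one, map_zero, add_zero]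

end Bimodule

/-! ### From a central unit to a decomposition of the kernel. -/

section Kernel

variable {Ω : Type*} {F : Type*} [NormedAddCommGroup F] [NormedSpace ℂ F] [HilbertBimodule 𝓑 F]

theorem inn_smul_smul (b c b' c' : 𝓑) (x y : F) :
    inn 𝓑 ((b • x) <• c) ((b' • y) <• c') = star c * inn 𝓑 x ((star b * b') • y) * c' := by
  rw [inn_smul_right_left, inn_smul_right, inn_smul_left, ← mul_smul, mul_assoc]

/-- The defining sum is `⟨v, v⟩` for `v = ∑ b_k x(σ_k) c_k`. -/
theorem isCPD_of_eq_inn {L : Ω → Ω → (𝓑 →L[ℂ] 𝓑)} (x : Ω → F)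
    (h : ∀ σ σ' b, L σ σ' b = inn 𝓑 (x σ) (b • x σ')) : IsCPD L := by
  intro n σ b c
  have := HilbertModule.inn_self_nonneg (𝓑 := 𝓑) (∑ k, (b k • x (σ k)) <• c k)
  convert this using 2
  change _ = inn 𝓑 _ _
  rw [inn_sum_left]
  refine Finset.sum_congr rfl fun k _ => ?_
  rw [inn_sum_right]
  refine Finset.sum_congr rfl fun l _ => ?_
  rw [h, inn_smul_smul]

theorem isCPD_conjKernel (b : Ω → 𝓑) : IsCPD (conjKernel b) :=
  isCPD_of_eq_inn (F := 𝓑) b fun _ _ _ => mul_assoc _ _ _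

theorem IsMinimalKolmogorov.exists_of_central_unit {K : Ω → Ω → (𝓑 →L[ℂ] 𝓑)} {i : Ω → F}
    (hi : IsMinimalKolmogorov K i) {ζ : F} (hζ : ζ ∈ center 𝓑 F) (h1 : inn 𝓑 ζ ζ = 1) :
    ∃ b : Ω → 𝓑, strongIdealSpan (Set.range b) = ⊤ ∧
      ∃ L : Ω → Ω → (𝓑 →L[ℂ] 𝓑), IsCPD L ∧
        ∀ (σ σ' : Ω) (x : 𝓑), K σ σ' x = star (b σ) * x * b σ' + L σ σ' x := by
  let b : Ω → 𝓑 := fun σ => inn 𝓑 ζ (i σ)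
  refine ⟨b, ?_, fun σ σ' => K σ σ' - conjKernel b σ σ', ?_, ?_⟩
  · rw [← TwoSidedIdeal.one_mem_iff, strongIdealSpan, TwoSidedIdeal.mem_sInf]
    rintro I ⟨hbI, hI⟩
    have hspan : ∀ x ∈ Submodule.span ℂ {x : F | ∃ (b : 𝓑) (σ : Ω) (c : 𝓑), x = (b • i σ) <• c},
        inn 𝓑 ζ x ∈ I := by
      intro x hx
      induction hx using Submodule.span_induction with
      | mem x hx =>
        obtain ⟨d, σ, c, rfl⟩ := hx
        rw [inn_smul_right, inn_center_smul hζ]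
        exact I.mul_mem_right _ _ (I.mul_mem_left _ _ (hbI ⟨σ, rfl⟩))
      | zero =>
        have : inn 𝓑 ζ (0 : F) = 0 := map_zero (innHom 𝓑 ζ)
        exact this ▸ I.zero_mem
      | add x y _ _ hx hy => rw [inn_add_right]; exact I.add_mem hx hy
      | smul c x _ hx =>
        -- A two-sided ideal is only known to absorb ring multiplication, so the scalar is written
        -- as the element `c • 1` of `𝓑`.
        rw [inn_smul_complex, ← one_mul (inn 𝓑 ζ x), ← smul_mul_assoc]
        exact I.mul_mem_left _ _ hx
    -- Applying `L_ζ*` to the strong approximation of `L_ζ` by the span approximates `⟨ζ, ζ⟩ = 1` by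
    -- elements of `I`.
    have h2 := comp_mem_strongClosure (ContinuousLinearMap.adjoint (creation 𝓑 ζ))
      (S' := (fun x : 𝓑 => (x : H →L[ℂ] H)) '' (I : Set 𝓑)) ?_ (hi.dense ζ)
    · obtain ⟨a, ha, ha'⟩ := isStronglyClosed_iff.1 hI h2
      have : a = 1 := by
        rw [← h1]
        ext h
        rw [← adjoint_creation_comp]
        exact DFunLike.congr_fun ha' h
      exact this ▸ ha
    · rintro _ ⟨x, hx, rfl⟩
      refine ⟨inn 𝓑 ζ x, hspan x hx, ?_⟩
      ext h
      exact (adjoint_creation_comp ζ x h).symm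
  -- `L` is represented by the components of the `i(σ)` orthogonal to `ζ`.
  · refine isCPD_of_eq_inn (fun σ => i σ - ζ <• b σ) fun σ σ' x => ?_
    change K σ σ' x - star (b σ) * x * b σ' = _
    rw [hi.kernel_eq, smul_sub, smul_left_right, hζ, inn_sub_right, inn_sub_left, inn_sub_left,
      inn_smul_right, inn_smul_right, inn_smul_right, inn_smul_right_left, inn_smul_right,
      inn_smul_right_left, inn_center_smul hζ, h1, ← star_inn (i σ) ζ]
    change _ - star (b σ) * x * b σ'
      = _ - star (b σ) * (x * b σ') - (star (b σ) * x * b σ' - star (b σ) * 1 * x * b σ')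
    rw [mul_one, mul_assoc]
    abel
  · intro σ σ' x
    change _ = _ + (K σ σ' x - star (b σ) * x * b σ')
    abel

end Kernel

end VNKernel

namespace VNKernel

variable {H : Type*} [NormedAddCommGroup H] [InnerProductSpace ℂ H] [CompleteSpace H]
  {𝓑 : VonNeumannAlgebra H}

theorem isStronglyClosed_coe : IsStronglyClosed (𝓑 : Set (H →L[ℂ] H)) := by
  refine isStronglyClosed_iff.2 fun T hT => mem_of_forall_commutant fun b' hb' v => ?_
  refine strongClosure_induction (p := fun f => b' (f v) = f (b' v)) ?_ ?_ hT
  · exact isClosed_eq (by fun_prop) (by fun_prop)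
  · exact fun A hA => commutant_apply hA hb' v

/-! ### Positive matrices over `𝓑` and domination of norms. -/

section Gram

variable {ι : Type*} [Fintype ι]

/-- A hermitian matrix over `𝓑` with positive `𝓑`-valued form is of the form `s* s`. -/
theorem exists_eq_star_mul_of_form_nonneg (T : ι → ι → 𝓑) (hT : ∀ k l, star (T l k) = T k l)
    (hpos : ∀ c : ι → 𝓑, 0 ≤ ((∑ k, ∑ l, star (c k) * T k l * c l : 𝓑) : H →L[ℂ] H)) :
    ∃ s : ι → ι → 𝓑, ∀ k l, T k l = ∑ m, star (s m k) * s m l := by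
  classical
  let _ : PartialOrder 𝓑 := CStarAlgebra.spectralOrder 𝓑
  have : StarOrderedRing 𝓑 := CStarAlgebra.spectralOrderedRing 𝓑
  let M : CStarMatrix ι ι 𝓑 := CStarMatrix.ofMatrix (Matrix.of T)
  have hM : ∀ k l, M k l = T k l := fun _ _ => rfl
  have hMsa : IsSelfAdjoint M := by
    ext k l
    rw [CStarMatrix.star_apply, hM, hM, hT]
  obtain ⟨a, c, hasa, hata, hc0⟩ := exists_of_isSelfAdjoint hMsa
  have hc : c = 0 := by
    -- The diagonal of `a M a`, with `a` self-adjoint, consists of values of the form at the columns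
    -- of `a`, hence is positive. As `a M a = -(c* c)`, this forces `c = 0`.
    have hkk : ∀ k, (a * M * a) k k = ∑ l, ∑ m, star (a l k) * T l m * a m k := by
      intro k
      rw [CStarMatrix.mul_apply, Finset.sum_comm]
      refine Finset.sum_congr rfl fun m _ => ?_
      rw [CStarMatrix.mul_apply, Finset.sum_mul]
      refine Finset.sum_congr rfl fun l _ => ?_
      rw [hM, ← CStarMatrix.star_apply, hasa]
    have hkk' : ∀ k, (star c * c) k k = ∑ m, star (c m k) * c m k := by
      intro k
      rw [CStarMatrix.mul_apply]
      rfl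
    have hnn : ∀ k m, 0 ≤ ((star (c m k) * c m k : 𝓑) : H →L[ℂ] H) :=
      fun k m => star_mul_self_nonneg (c m k : H →L[ℂ] H)
    ext m k : 2
    have h0 : ∑ m, ((star (c m k) * c m k : 𝓑) : H →L[ℂ] H) = 0 := by
      apply le_antisymm
      · have h2 := hpos fun l => a l k
        rw [← hkk, hata] at h2
        change 0 ≤ ((-(star c * c) k k : 𝓑) : H →L[ℂ] H) at h2
        rw [hkk'] at h2
        rw [← coe_sum_vn]
        exact neg_nonneg.1 h2
      · exact Finset.sum_nonneg fun m _ => hnn k m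
    have h1 := (Finset.sum_eq_zero_iff_of_nonneg fun m _ => hnn k m).1 h0 m (Finset.mem_univ m)
    exact (CStarRing.star_mul_self_eq_zero_iff (c m k : H →L[ℂ] H)).1 h1
  obtain ⟨r, hr⟩ := hc0 hc
  refine ⟨fun m k => r m k, fun k l => ?_⟩
  rw [← hM, hr, CStarMatrix.mul_apply]
  rfl

theorem sum_inner_star_mul (s : ι → ι → 𝓑) (h : ι → H) :
    ∑ k, ∑ l, ⟪h k, ((∑ m, star (s m k) * s m l : 𝓑) : H →L[ℂ] H) (h l)⟫_ℂ
      = ∑ m, ⟪∑ k, (s m k : H →L[ℂ] H) (h k), ∑ l, (s m l : H →L[ℂ] H) (h l)⟫_ℂ := by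
  simp only [sum_inner, inner_sum, coe_sum_vn, sum_apply]
  symm
  rw [Finset.sum_comm]
  refine (Finset.sum_congr rfl fun k _ => Finset.sum_comm).trans ?_
  rw [Finset.sum_comm]
  refine Finset.sum_congr rfl fun k _ => Finset.sum_congr rfl fun l _ =>
    Finset.sum_congr rfl fun m _ => ?_
  change _ = ⟪h _, ContinuousLinearMap.adjoint (s m _ : H →L[ℂ] H) ((s m _ : H →L[ℂ] H) (h _))⟫_ℂ
  rw [ContinuousLinearMap.adjoint_inner_right]

/-- Positivity tested with coefficients in `𝓑` passes to arbitrary vectors of `H`, through the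
factorization `T = s* s`. -/
theorem re_form_nonneg {T : ι → ι → 𝓑} (hT : ∀ k l, star (T l k) = T k l)
    (hpos : ∀ c : ι → 𝓑, 0 ≤ ((∑ k, ∑ l, star (c k) * T k l * c l : 𝓑) : H →L[ℂ] H))
    (h : ι → H) : 0 ≤ RCLike.re (∑ k, ∑ l, ⟪h k, (T k l : H →L[ℂ] H) (h l)⟫_ℂ) := by
  obtain ⟨s, hs⟩ := exists_eq_star_mul_of_form_nonneg T hT hpos
  simp only [hs]
  rw [sum_inner_star_mul, map_sum]
  exact Finset.sum_nonneg fun m _ => inner_self_nonneg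

theorem IsCPD.nonneg_of_fintype {Ω : Type*} {L : Ω → Ω → (𝓑 →L[ℂ] 𝓑)} (hL : IsCPD L)
    (σ : ι → Ω) (b c : ι → 𝓑) :
    0 ≤ ((∑ k, ∑ l, star (c k) * L (σ k) (σ l) (star (b k) * b l) * c l : 𝓑) : H →L[ℂ] H) := by
  let e := (Fintype.equivFin ι).symm
  have := hL _ (σ ∘ e) (b ∘ e) (c ∘ e)
  convert this using 2
  rw [← e.sum_comp]
  exact Finset.sum_congr rfl fun k _ => (e.sum_comp _).symm

variable {E : Type*} [NormedAddCommGroup E] [NormedSpace ℂ E] [HilbertModule 𝓑 E]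

theorem norm_sum_le_of_form_nonneg (x : ι → E) (y : ι → 𝓑)
    (hpos : ∀ c : ι → 𝓑, 0 ≤ ((∑ k, ∑ l, star (c k) *
      (inn 𝓑 (x k) (x l) - star (y k) * y l) * c l : 𝓑) : H →L[ℂ] H)) (h : ι → H) :
    ‖∑ k, (y k : H →L[ℂ] H) (h k)‖ ≤ ‖∑ k, creation 𝓑 (x k) (h k)‖ := by
  have h0 := re_form_nonneg (fun k l => by rw [star_sub, star_inn, star_mul, star_star]) hpos h
  have h1 : ∀ k l, ⟪h k, ((inn 𝓑 (x k) (x l) - star (y k) * y l : 𝓑) : H →L[ℂ] H) (h l)⟫_ℂ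
      = ⟪creation 𝓑 (x k) (h k), creation 𝓑 (x l) (h l)⟫_ℂ
        - ⟪(y k : H →L[ℂ] H) (h k), (y l : H →L[ℂ] H) (h l)⟫_ℂ := fun k l => by
    rw [inner_creation, ← ContinuousLinearMap.adjoint_inner_right (y k : H →L[ℂ] H),
      ← inner_sub_right]
    rfl
  have h2 : ⟪∑ k, creation 𝓑 (x k) (h k), ∑ k, creation 𝓑 (x k) (h k)⟫_ℂ
      = ∑ k, ∑ l, ⟪creation 𝓑 (x k) (h k), creation 𝓑 (x l) (h l)⟫_ℂ := by
    rw [sum_inner]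
    exact Finset.sum_congr rfl fun k _ => inner_sum _ _ _
  have h3 : ⟪∑ k, (y k : H →L[ℂ] H) (h k), ∑ k, (y k : H →L[ℂ] H) (h k)⟫_ℂ
      = ∑ k, ∑ l, ⟪(y k : H →L[ℂ] H) (h k), (y l : H →L[ℂ] H) (h l)⟫_ℂ := by
    rw [sum_inner]
    exact Finset.sum_congr rfl fun k _ => inner_sum _ _ _
  simp only [h1, Finset.sum_sub_distrib, map_sub] at h0
  rw [← h2, ← h3, sub_nonneg] at h0
  rw [← sq_le_sq₀ (norm_nonneg _) (norm_nonneg _), @norm_sq_eq_re_inner ℂ,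
    @norm_sq_eq_re_inner ℂ]
  exact h0

end Gram

/-! ### From a decomposition of the kernel to a central vector. -/

section Kernel

variable {Ω : Type*} {F : Type*} [NormedAddCommGroup F] [NormedSpace ℂ F] [HilbertBimodule 𝓑 F]
  {K : Ω → Ω → (𝓑 →L[ℂ] 𝓑)} {i : Ω → F}

/-- The right factor moves into `H`, since `(x c) ⊗ h = x ⊗ c h`; this makes the vectors on which
`V` is prescribed total. -/
theorem IsMinimalKolmogorov.dense_span (hi : IsMinimalKolmogorov K i) :
    Dense (Submodule.span ℂ (Set.range fun j : Ω × 𝓑 × H =>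
      creation 𝓑 (j.2.1 • i j.1) j.2.2) : Set (Interior 𝓑 F)) := by
  set N := Submodule.span ℂ (Set.range fun j : Ω × 𝓑 × H => creation 𝓑 (j.2.1 • i j.1) j.2.2)
  have h1 : ∀ x ∈ Submodule.span ℂ {x : F | ∃ (b : 𝓑) (σ : Ω) (c : 𝓑), x = (b • i σ) <• c},
      ∀ h, creation 𝓑 x h ∈ N.topologicalClosure := by
    intro x hx h
    refine N.le_topologicalClosure ?_
    induction hx using Submodule.span_induction with
    | mem x hx =>
      obtain ⟨d, σ, c, rfl⟩ := hx
      rw [creation_smul_right]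
      exact Submodule.subset_span ⟨(σ, d, (c : H →L[ℂ] H) h), rfl⟩
    | zero =>
      have : creation 𝓑 (0 : F) = 0 := map_zero (creationHom 𝓑 F)
      rw [this]
      exact N.zero_mem
    | add x y _ _ hx hy => rw [creation_add]; exact N.add_mem hx hy
    | smul c x _ hx => rw [creation_smul]; exact N.smul_mem c hx
  have h2 : ∀ (x : F) h, creation 𝓑 x h ∈ N.topologicalClosure := by
    intro x h
    refine strongClosure_induction (p := fun f => f h ∈ N.topologicalClosure) ?_ ?_ (hi.dense x)
    · exact N.isClosed_topologicalClosure.preimage (continuous_apply h)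
    · rintro _ ⟨x, hx, rfl⟩
      exact h1 x hx h
  have h3 : Submodule.span ℂ {u : Interior 𝓑 F | ∃ (x : F) (h : H), u = creation 𝓑 x h}
      ≤ N.topologicalClosure := by
    rw [Submodule.span_le]
    rintro _ ⟨x, h, rfl⟩
    exact h2 x h
  have h4 := dense_span_creation.mono h3
  rw [Submodule.topologicalClosure_coe, dense_closure] at h4
  exact h4

/-- A kernel dominated by `K` of the form `(b σ)* x (b σ')` comes from a vector of `F`. -/
theorem IsMinimalKolmogorov.exists_vector (hi : IsMinimalKolmogorov K i) {b : Ω → 𝓑}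
    {L : Ω → Ω → (𝓑 →L[ℂ] 𝓑)} (hL : IsCPD L)
    (hK : ∀ (σ σ' : Ω) (x : 𝓑), K σ σ' x = star (b σ) * x * b σ' + L σ σ' x) :
    ∃ ζ : F, ∀ (d : 𝓑) (σ : Ω), inn 𝓑 ζ (d • i σ) = d * b σ := by
  obtain ⟨V, hV⟩ := exists_clm_of_norm_le
    (w := fun j : Ω × 𝓑 × H => ((j.2.1 * b j.1 : 𝓑) : H →L[ℂ] H) j.2.2) hi.dense_span fun g => by
      have := norm_sum_le_of_form_nonneg (𝓑 := 𝓑) (fun j : g.support => j.1.2.1 • i j.1.1)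
        (fun j : g.support => j.1.2.1 * b j.1.1) (fun c => by
          -- The Gram matrix of the `d_k i(σ_k)` minus `(d_k b^{σ_k})* (d_l b^{σ_l})` is exactly
          -- `L(d_k* d_l)`. The scalars `g j` are absorbed into the vectors of `H`.
          have h1 := hL.nonneg_of_fintype (fun j : g.support => j.1.1)
            (fun j : g.support => j.1.2.1) c
          convert h1 using 10 with k _ l _
          rw [inn_smul_left, ← mul_smul, ← hi.kernel_eq, hK, star_mul, mul_assoc, mul_assoc,
            mul_assoc, add_sub_cancel_left]) (fun j => g j • j.1.2.2)
      simp only [map_smul] at this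
      rw [Finsupp.linearCombination_apply, Finsupp.linearCombination_apply, Finsupp.sum,
        Finsupp.sum, ← Finset.sum_coe_sort, ← Finset.sum_coe_sort g.support]
      exact this
  have hVi : ∀ (d : 𝓑) (σ : Ω) (h : H),
      V (creation 𝓑 (d • i σ) h) = ((d * b σ : 𝓑) : H →L[ℂ] H) h := fun d σ h => hV (σ, d, h)
  have hspan : ∀ x ∈ Submodule.span ℂ {x : F | ∃ (b : 𝓑) (σ : Ω) (c : 𝓑), x = (b • i σ) <• c},
      V ∘L creation 𝓑 x ∈ 𝓑 := by
    intro x hx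
    induction hx using Submodule.span_induction with
    | mem x hx =>
      obtain ⟨d, σ, c, rfl⟩ := hx
      have : V ∘L creation 𝓑 ((d • i σ) <• c) = ((d * b σ * c : 𝓑) : H →L[ℂ] H) := by
        ext h
        rw [ContinuousLinearMap.comp_apply, creation_smul_right, hVi]
        rfl
      rw [this]
      exact SetLike.coe_mem _
    | zero =>
      have : creation 𝓑 (0 : F) = 0 := map_zero (creationHom 𝓑 F)
      rw [this, ContinuousLinearMap.comp_zero]
      exact zero_mem _
    | add x y _ _ hx hy =>
      rw [creation_add, ContinuousLinearMap.comp_add]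
      exact add_mem hx hy
    | smul c x _ hx =>
      rw [creation_smul, ContinuousLinearMap.comp_smul]
      exact SMulMemClass.smul_mem c hx
  have hVmem : ∀ x : F, V ∘L creation 𝓑 x ∈ 𝓑 := fun x =>
    isStronglyClosed_iff.1 isStronglyClosed_coe <| comp_mem_strongClosure V
      (by rintro _ ⟨x, hx, rfl⟩; exact hspan x hx) (hi.dense x)
  obtain ⟨ζ, hζ⟩ := hi.isVonNeumannModule.exists_creation_eq (ContinuousLinearMap.adjoint V)
    fun y => by
      -- `L_y* V* = (V L_y)*`, and `𝓑` is closed under adjoints.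
      rw [← ContinuousLinearMap.adjoint_comp]
      exact star_mem (hVmem y)
  refine ⟨ζ, fun d σ => ?_⟩
  ext h
  rw [← adjoint_creation_comp, hζ, ContinuousLinearMap.adjoint_adjoint, hVi]

/-- Both `⟨dζ, a i(σ) c⟩` and `⟨ζd, a i(σ) c⟩` equal `d* a b^σ c`, so `dζ - ζd` is orthogonal to a
strongly dense set and hence to itself. -/
theorem IsMinimalKolmogorov.mem_center (hi : IsMinimalKolmogorov K i) {b : Ω → 𝓑} {ζ : F}
    (hζ : ∀ (d : 𝓑) (σ : Ω), inn 𝓑 ζ (d • i σ) = d * b σ) : ζ ∈ center 𝓑 F := by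
  intro d
  rw [← sub_eq_zero]
  apply HilbertModule.inn_self_eq_zero (𝓑 := 𝓑)
  refine inn_eq_zero_of_mem_strongClosure (hi.dense _) fun y hy => ?_
  induction hy using Submodule.span_induction with
  | mem y hy =>
    obtain ⟨a, σ, c, rfl⟩ := hy
    rw [inn_smul_right, inn_sub_left, inn_smul_left, inn_smul_right_left, ← mul_smul, hζ, hζ,
      mul_assoc, sub_self, zero_mul]
  | zero => exact map_zero (innHom 𝓑 _)
  | add x y _ _ hx hy => rw [inn_add_right, hx, hy, add_zero]
  | smul c x _ hx => rw [inn_smul_complex, hx, smul_zero]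

theorem inn_self_commute {ζ : F} (hζ : ζ ∈ center 𝓑 F) (d : 𝓑) :
    Commute d (inn 𝓑 ζ ζ) := by
  change d * inn 𝓑 ζ ζ = inn 𝓑 ζ ζ * d
  rw [← inn_center_smul hζ, hζ, inn_smul_right]

/-- The `a ∈ 𝓑` whose adjoint kills `ker ⟨ζ, ζ⟩` form a strongly closed two-sided ideal: that kernel
is invariant under `𝓑`, because `⟨ζ, ζ⟩` commutes with `𝓑`. The ideal contains every `⟨ζ, x⟩`, hence
`1`. -/
theorem eq_zero_of_inn_self_apply {ζ : F} (hζ : ζ ∈ center 𝓑 F) {s : Set 𝓑}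
    (hs : strongIdealSpan s = ⊤) (hsζ : ∀ a ∈ s, ∃ x, a = inn 𝓑 ζ x) {h : H}
    (hh : (inn 𝓑 ζ ζ : H →L[ℂ] H) h = 0) : h = 0 := by
  let I : TwoSidedIdeal 𝓑 := TwoSidedIdeal.mk'
    {a : 𝓑 | ∀ h, (inn 𝓑 ζ ζ : H →L[ℂ] H) h = 0 →
      ContinuousLinearMap.adjoint (a : H →L[ℂ] H) h = 0}
    (fun h _ => by
      change ContinuousLinearMap.adjoint (0 : H →L[ℂ] H) h = 0
      rw [map_zero]; rfl)
    (fun {x y} hx hy h hh => by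
      change ContinuousLinearMap.adjoint ((x : H →L[ℂ] H) + (y : H →L[ℂ] H)) h = 0
      rw [map_add, add_apply, hx h hh, hy h hh, add_zero])
    (fun {x} hx h hh => by
      change ContinuousLinearMap.adjoint (-(x : H →L[ℂ] H)) h = 0
      rw [map_neg, neg_apply, hx h hh, neg_zero])
    (fun {x y} hy h hh => by
      change ContinuousLinearMap.adjoint ((x : H →L[ℂ] H) ∘L (y : H →L[ℂ] H)) h = 0
      rw [ContinuousLinearMap.adjoint_comp]
      refine hy _ ?_
      have := congrArg (fun A : 𝓑 => (A : H →L[ℂ] H) h) (inn_self_commute hζ (star x)).eq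
      refine this.symm.trans ?_
      change ((star x : 𝓑) : H →L[ℂ] H) ((inn 𝓑 ζ ζ : H →L[ℂ] H) h) = 0
      rw [hh, map_zero])
    (fun {x y} hx h hh => by
      change ContinuousLinearMap.adjoint ((x : H →L[ℂ] H) ∘L (y : H →L[ℂ] H)) h = 0
      rw [ContinuousLinearMap.adjoint_comp, ContinuousLinearMap.comp_apply, hx h hh, map_zero])
  have hI : ∀ a : 𝓑, a ∈ I ↔ ∀ h, (inn 𝓑 ζ ζ : H →L[ℂ] H) h = 0 →
      ContinuousLinearMap.adjoint (a : H →L[ℂ] H) h = 0 := fun a =>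
    TwoSidedIdeal.mem_mk' _ _ _ _ _ _ a
  have h1 : (1 : 𝓑) ∈ strongIdealSpan s := hs ▸ trivial
  rw [strongIdealSpan, TwoSidedIdeal.mem_sInf] at h1
  have h2 := (hI 1).1 (h1 I ⟨fun a ha => (hI a).2 fun k hk => ?_, ?_⟩) h hh
  · change ContinuousLinearMap.adjoint (1 : H →L[ℂ] H) h = 0 at h2
    rwa [← ContinuousLinearMap.star_eq_adjoint, star_one] at h2
  · obtain ⟨x, rfl⟩ := hsζ a ha
    -- `‖ζ ⊗ k‖² = ⟪k, ⟨ζ, ζ⟩ k⟫ = 0`, and `⟨ζ, x⟩* k = L_x* (ζ ⊗ k)`.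
    have h3 : creation 𝓑 ζ k = 0 := by
      rw [← inner_self_eq_zero (𝕜 := ℂ), inner_creation, hk, inner_zero_right]
    rw [coe_inn_star, ← adjoint_creation_comp, h3, map_zero]
  · refine isStronglyClosed_iff.2 fun T hT => ?_
    have hT𝓑 : T ∈ 𝓑 := isStronglyClosed_iff.1 isStronglyClosed_coe <|
      comp_mem_strongClosure (ContinuousLinearMap.id ℂ H) (by rintro _ ⟨a, _, rfl⟩; exact a.2) hT
    refine ⟨⟨T, hT𝓑⟩, (hI _).2 fun k hk => ?_, rfl⟩
    -- Taking adjoints is not strongly continuous in general; the condition is restated as `⟪k, a v⟫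
    -- = 0` for all `v`, which is closed under pointwise limits.
    refine ext_inner_right ℂ fun v => ?_
    rw [ContinuousLinearMap.adjoint_inner_left, inner_zero_left]
    refine strongClosure_induction (p := fun f => ⟪k, f v⟫_ℂ = 0) ?_ ?_ hT
    · exact isClosed_eq (by fun_prop) continuous_const
    · rintro _ ⟨a, ha, rfl⟩
      rw [← ContinuousLinearMap.adjoint_inner_left, (hI a).1 ha k hk, inner_zero_left]

end Kernel

end VNKernel

/-! ### Polar decomposition of a central vector. -/

namespace VNKernel

variable {H : Type*} [NormedAddCommGroup H] [InnerProductSpace ℂ H] [CompleteSpace H]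
  {𝓑 : VonNeumannAlgebra H}

/-- The square root of a positive element `z` of `𝓑`; it commutes with whatever commutes
with `z`. -/
theorem exists_sqrt (z : 𝓑) (hz : 0 ≤ (z : H →L[ℂ] H)) :
    ∃ s : 𝓑, star s = s ∧ s * s = z ∧ ∀ d, Commute d z → Commute d s := by
  have hcomm : ∀ d : H →L[ℂ] H, Commute d (z : H →L[ℂ] H) →
      Commute d (CFC.sqrt (z : H →L[ℂ] H)) := fun d hd =>
    (Commute.cfcₙ_nnreal hd.symm NNReal.sqrt).symm
  have hmem : CFC.sqrt (z : H →L[ℂ] H) ∈ 𝓑 := mem_of_forall_commutant fun b' hb' v =>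
    DFunLike.congr_fun (hcomm b' (ContinuousLinearMap.ext fun v => commutant_apply z.2 hb' v)).eq v
  refine ⟨⟨_, hmem⟩, Subtype.ext ?_, Subtype.ext (CFC.sqrt_mul_sqrt_self _ hz), fun d hd =>
    Subtype.ext (hcomm d (congrArg Subtype.val hd.eq)).eq⟩
  exact (IsSelfAdjoint.of_nonneg (CFC.sqrt_nonneg (z : H →L[ℂ] H))).star_eq

variable {F : Type*} [NormedAddCommGroup F] [NormedSpace ℂ F] [HilbertBimodule 𝓑 F]

/-- Polar decomposition of a central vector with injective `⟨ζ, ζ⟩`. -/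
theorem IsVonNeumannModule.exists_central_unit (hF : IsVonNeumannModule 𝓑 F) {ζ : F}
    (hζ : ζ ∈ center 𝓑 F)
    (hinj : ∀ h : H, (inn 𝓑 ζ ζ : H →L[ℂ] H) h = 0 → h = 0) :
    ∃ ξ ∈ center 𝓑 F, inn 𝓑 ξ ξ = 1 := by
  obtain ⟨s, hs, hss, hcomm⟩ := exists_sqrt (inn 𝓑 ζ ζ) (HilbertModule.inn_self_nonneg ζ)
  have hsa : ContinuousLinearMap.adjoint (s : H →L[ℂ] H) = (s : H →L[ℂ] H) :=
    congrArg Subtype.val hs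
  have hss' : ∀ h, (s : H →L[ℂ] H) ((s : H →L[ℂ] H) h) = (inn 𝓑 ζ ζ : H →L[ℂ] H) h := fun h =>
    congrArg (fun A : 𝓑 => (A : H →L[ℂ] H) h) hss
  -- As `s` is self-adjoint, the orthogonal complement of its range is `ker s`, contained in `ker s²
  -- = ker ⟨ζ, ζ⟩ = 0`.
  have hd : Dense (Set.range (s : H →L[ℂ] H)) := by
    have h1 : (LinearMap.range (s : H →L[ℂ] H).toLinearMap)ᗮ = ⊥ := by
      rw [eq_bot_iff]
      intro h hh
      refine (Submodule.mem_bot ℂ).2 (hinj h ?_)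
      rw [← hss']
      have h2 : (s : H →L[ℂ] H) h = 0 := by
        refine ext_inner_left ℂ fun v => ?_
        rw [inner_zero_right, ← hsa, ContinuousLinearMap.adjoint_inner_right]
        exact (Submodule.mem_orthogonal _ _).1 hh _ ⟨v, rfl⟩
      rw [h2, map_zero]
    rw [← Submodule.topologicalClosure_eq_top_iff, ← Submodule.dense_iff_topologicalClosure_eq_top]
      at h1
    exact h1
  -- `W : s h ↦ ζ ⊗ h` is the isometric factor in `L_ζ = W s`.
  obtain ⟨W, hW, hWn⟩ := exists_isometry_of_inner_eq (u := fun h => (s : H →L[ℂ] H) h)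
    (w := fun h => creation 𝓑 ζ h) (hd.mono Submodule.subset_span) fun h k => by
      rw [inner_creation, ← hss', ← ContinuousLinearMap.adjoint_inner_left, hsa]
  -- On the dense range of `s`, `L_y* W (s h) = ⟨y, ζ⟩ h`; since `s` and `⟨y, ζ⟩` commute with `𝓑'`,
  -- so does `L_y* W`.
  obtain ⟨ξ, hξ⟩ := hF.exists_creation_eq W fun y => mem_of_forall_commutant fun b' hb' v => by
    refine hd.induction (P := fun v => b' ((ContinuousLinearMap.adjoint (creation 𝓑 y) ∘L W) v)
      = (ContinuousLinearMap.adjoint (creation 𝓑 y) ∘L W) (b' v)) ?_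
      (isClosed_eq (by fun_prop) (by fun_prop)) v
    rintro _ ⟨h, rfl⟩
    rw [commutant_apply s.2 hb', ContinuousLinearMap.comp_apply, ContinuousLinearMap.comp_apply,
      hW, hW, adjoint_creation_comp, adjoint_creation_comp,
      commutant_apply (SetLike.coe_mem _) hb']
  have hcancel : ∀ x y : F, x <• s = y <• s → x = y := by
    intro x y hxy
    apply creation_injective (𝓑 := 𝓑)
    ext v
    refine hd.induction (P := fun v => creation 𝓑 x v = creation 𝓑 y v) ?_
      (isClosed_eq (by fun_prop) (by fun_prop)) v
    rintro _ ⟨h, rfl⟩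
    rw [← creation_smul_right, hxy, creation_smul_right]
  have hξs : ξ <• s = ζ := by
    apply creation_injective (𝓑 := 𝓑)
    ext h
    rw [creation_smul_right, hξ, hW]
  refine ⟨ξ, fun b => hcancel _ _ ?_, ?_⟩
  -- After multiplication by `s`: `bξs = bζ = ζb = ξsb = ξbs`.
  · rw [← smul_left_right, hξs, hζ, ← mul_smul, ← MulOpposite.op_mul,
      (hcomm b (inn_self_commute hζ b)).eq, MulOpposite.op_mul, mul_smul, hξs]
  · ext h
    refine ext_inner_left ℂ fun k => ?_
    rw [← inner_creation, hξ]
    exact LinearIsometry.inner_map_map ⟨W.toLinearMap, hWn⟩ k h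

end VNKernel

open VNKernel in
theorem mainTheorem8 {H : Type*} [NormedAddCommGroup H] [InnerProductSpace ℂ H] [CompleteSpace H]
    (𝓑 : VonNeumannAlgebra H) {Ω : Type*} (K : Ω → Ω → (𝓑 →L[ℂ] 𝓑)) (hK : IsCPD K)
    {F : Type*} [NormedAddCommGroup F] [NormedSpace ℂ F] [CompleteSpace F] [HilbertBimodule 𝓑 F]
    (i : Ω → F) (hi : IsMinimalKolmogorov K i) :
    List.TFAE [
      ∃ ζ ∈ center 𝓑 F, inn 𝓑 ζ ζ = 1,
      ∃ F' : SubBimodule 𝓑 F, IsVonNeumannModule 𝓑 F'.toSubmodule ∧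
        Nonempty (DirectSumIso 𝓑 F 𝓑 F'.toSubmodule),
      ∃ b : Ω → 𝓑, strongIdealSpan (Set.range b) = ⊤ ∧
        ∃ L : Ω → Ω → (𝓑 →L[ℂ] 𝓑), IsCPD L ∧
          ∀ (σ σ' : Ω) (x : 𝓑), K σ σ' x = star (b σ) * x * b σ' + L σ σ' x] ∧
    ∀ b : Ω → 𝓑, IsCPD (conjKernel b) := by
  refine ⟨?_, isCPD_conjKernel⟩
  tfae_have 1 → 2
  | ⟨ζ, hζ, h1⟩ => ⟨centralComplement ζ hζ,
      isVonNeumannModule_centralComplement hi.isVonNeumannModule ζ hζ, ⟨centralSplitting ζ hζ h1⟩⟩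
  tfae_have 2 → 1
  | ⟨_, _, ⟨e⟩⟩ => e.exists_central_unit
  tfae_have 1 → 3
  | ⟨_, hζ, h1⟩ => hi.exists_of_central_unit hζ h1
  tfae_have 3 → 1
  | ⟨b, hb, L, hL, hKL⟩ => by
    obtain ⟨ζ, hζ⟩ := hi.exists_vector hL hKL
    have hc := hi.mem_center hζ
    refine hi.isVonNeumannModule.exists_central_unit hc fun h hh =>
      eq_zero_of_inn_self_apply hc hb ?_ hh
    rintro _ ⟨σ, rfl⟩
    exact ⟨i σ, by rw [← one_smul (↥𝓑) (i σ), hζ, one_mul]⟩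
  tfae_finish
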